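/- **Setting.** All tensor products are Hilbert space tensor products, and $A_{ij}$ denotes the operator $A$ acting on the $i$-th and $j$-th tensor factors. For a closed real subspace $H$ of a complex Hilbert space $\mathcal H$ put $H'=\{x\in\mathcal H:\ \mathrm{Im}\langle h,x\rangle=0\ \text{for all }h\in H\}$. $H$ is *standard* if $H\cap iH=\{0\}$ and $\overline{H+iH}=\mathcal H$; its modular objects $J_H$ (an antiunitary involution) and $\Delta_H^{it}$ are given by the polar decomposition $S_H=J_H\Delta_H^{1/2}$ of the involution $S_H:f+ig\mapsto f-ig$ ($f,g\in H$). A *standard pair* $(H,T)$ is a standard subspace $H$ with a strongly continuous unitary one-parameter group $T(t)=e^{itP}$ such that $T(t)H\subset H$ for $t\ge 0$, $P\ge 0$, and $0$ is not an eigenvalue of $P$. $\mathcal S(H,T)$ is the set of unitaries $R$ on $\mathcal H\otimes\mathcal H$ such that 1. $R_{21}=R^*$; 2. $R_{12}R_{13}R_{23}=R_{23}R_{13}R_{12}$; 3. $[R,T(t_1)\otimes T(t_2)]=0$ for all $t_1,t_2\in\mathbb R$; 4. $[R,\Delta_H^{it}\otimes\Delta_H^{it}]=0$ for all $t\in\mathbb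 R$, and $R(J_H\otimes J_H)=(J_H\otimes J_H)R^*$; 5. $\langle g'\otimes\eta,R(f\otimes\xi)\rangle=\langle f\otimes\eta,R^*(g'\otimes\xi)\rangle$ for all $f\in H$, $g'\in H'$, $\xi,\eta\in\mathcal H$. Given standard pairs $(H_\pm,T_\pm)$ on $\mathcal H_\pm$ and $R^\pm\in\mathcal S(H_\pm,T_\pm)$, $\mathcal S(R^+,R^-)$ is the set of unitaries $S$ on $\mathcal H_+\otimes\mathcal H_-$ such that 1. $[S,\Delta_{H_+}^{it}\otimes\Delta_{H_-}^{-it}]=0$ for all $t\in\mathbb R$; 2. $[S,T_+(t_+)\otimes T_-(t_-)]=0$ for all $t_+,t_-\in\mathbb R$; 3. $R^+_{12}S_{13}S_{23}=S_{23}S_{13}R^+_{12}$ on $\mathcal H_+\otimes\mathcal H_+\otimes\mathcal H_-$; 4. $R^-_{23}S_{12}S_{13}=S_{13}S_{12}R^-_{23}$ on $\mathcal H_+\otimes\mathcal H_-\otimes\mathcal H_-$; 5. $\langle g'\otimes\eta,S(f\otimes\xi)\rangle=\langle f\otimes\eta,S^*(g'\otimes\xi)\rangle$ for all $f\in H_+$,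 $g'\in H_+'$, $\xi,\eta\in\mathcal H_-$; 6. $\langle\eta\otimes g',S(\xi\otimes f)\rangle=\langle\eta\otimes f,S^*(\xi\otimes g')\rangle$ for all $f\in H_-$, $g'\in H_-'$, $\xi,\eta\in\mathcal H_+$. Let $(H,T)$ be a standard pair of finite multiplicity $n$. Identify $\mathcal H$ with $L^2(\mathbb R,\mathbb C^n)$ so that, for some involution $\alpha\mapsto\bar\alpha$ of the index set, $(T(t)f)(q)=e^{ite^q}f(q)$, $(\Delta_H^{it}f)(q)=f(q-2\pi t)$ and $(J_Hf)^\alpha(q)=\overline{f^{\bar\alpha}(q)}$. Write $Q=\ln P$, i.e. multiplication by $q$. **Proposition.** Let $R\in\mathcal S(H,T)$. Then $R=\underline R(Q\otimes 1-1\otimes Q)$ for a measurable, almost everywhere unitary matrix-valued function $\underline R=(\underline R^{\alpha\beta}_{\gamma\delta})$ on $\mathbb R$, i.e. $$(R\xi)^{\alpha\beta}(q_1,q_2)=\sum_{\gamma,\delta}\underline R^{\alpha\beta}_{\gamma\delta}(q_1-q_2)\,\xi^{\gamma\delta}(q_1,q_2).$$ If $\underline R$ has the flip symmetry $\underline R^{\alpha\beta}_{\gamma\delta}(q)=\underline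 R^{\beta\alpha}_{\delta\gamma}(q)$ for almost every $q$ (that is, $F\underline R(q)F=\underline R(q)$ with $F$ the flip of $\mathbb C^n\otimes\mathbb C^n$), then the operator $\breve S=\underline R(Q\otimes 1+1\otimes Q)$, i.e. $$(\breve S\xi)^{\alpha\beta}(q_1,q_2)=\sum_{\gamma,\delta}\underline R^{\alpha\beta}_{\gamma\delta}(q_1+q_2)\,\xi^{\gamma\delta}(q_1,q_2),$$ is well defined and belongs to $\mathcal S(R,R)$. -/

import Mathlib

open MeasureTheory Complex
open scoped TensorProduct ComplexConjugate

noncomputable section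

/-! ### Hilbert space tensor products -/

section Tensor

variable {E F G E' F' : Type*}
  [NormedAddCommGroup E] [InnerProductSpace ℂ E]
  [NormedAddCommGroup F] [InnerProductSpace ℂ F]
  [NormedAddCommGroup G] [InnerProductSpace ℂ G]
  [NormedAddCommGroup E'] [InnerProductSpace ℂ E']
  [NormedAddCommGroup F'] [InnerProductSpace ℂ F']

variable (E F) in
/-- The Hilbert space tensor product: the completion of the algebraic tensor product
with respect to its inner product. -/
abbrev HTensor : Type _ := UniformSpace.Completion (E ⊗[ℂ] F)

namespace HTensor

/-- The elementary tensor `x ⊗ y`. -/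
def tmul (x : E) (y : F) : HTensor E F := ((x ⊗ₜ[ℂ] y : E ⊗[ℂ] F) : HTensor E F)

variable (E F) in
/-- The isometric embedding of the algebraic tensor product into the Hilbert tensor product. -/
def incl : E ⊗[ℂ] F →ₗᵢ[ℂ] HTensor E F := UniformSpace.Completion.toComplₗᵢ

variable (E F) in
theorem denseRange_incl : DenseRange (incl E F).toLinearMap :=
  UniformSpace.Completion.denseRange_coe

theorem incl_tmul (x : E) (y : F) : incl E F (x ⊗ₜ[ℂ] y) = tmul x y := rfl

/-- The unitary `A ⊗ B` for unitaries `A` and `B`. -/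
def map (A : E ≃ₗᵢ[ℂ] E') (B : F ≃ₗᵢ[ℂ] F') : HTensor E F ≃ₗᵢ[ℂ] HTensor E' F' :=
  (TensorProduct.congrIsometry A B).toLinearEquiv.extendOfIsometry
    (incl E F).toLinearMap (incl E' F').toLinearMap
    (denseRange_incl E F) (denseRange_incl E' F') (fun x => by
      change ‖incl E' F' (TensorProduct.congrIsometry A B x)‖ = ‖incl E F x‖
      simp only [LinearIsometry.norm_map, LinearIsometryEquiv.norm_map])

theorem inner_antiunitary (L : E ≃ₗᵢ⋆[ℂ] E') (a b : E) : inner ℂ (L a) (L b) = inner ℂ b a := by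
  have h₁ : ‖L a + L b‖ = ‖b + a‖ := by
    rw [← map_add, L.norm_map, add_comm]
  have h₂ : ‖L a - L b‖ = ‖b - a‖ := by
    rw [← map_sub, L.norm_map, norm_sub_rev]
  have h₃ : ‖L a - I • L b‖ = ‖b - I • a‖ := by
    have : L a - I • L b = L (I • (b - I • a)) := by
      rw [L.map_smulₛₗ, map_sub, L.map_smulₛₗ, conj_I, smul_sub, smul_smul]
      simp [add_comm, sub_eq_add_neg]
    rw [this, L.norm_map, norm_smul, norm_I, one_mul]
  have h₄ : ‖L a + I • L b‖ = ‖b + I • a‖ := by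
    have : L a + I • L b = L (-I • (b + I • a)) := by
      rw [L.map_smulₛₗ, map_add, L.map_smulₛₗ, map_neg, conj_I, smul_add, smul_smul]
      simp [add_comm]
    rw [this, L.norm_map, norm_smul, norm_neg, norm_I, one_mul]
  rw [inner_eq_sum_norm_sq_div_four, inner_eq_sum_norm_sq_div_four]
  simp only [RCLike.I_to_complex, h₁, h₂, h₃, h₄]

theorem inner_conj_congr (J : E ≃ₗᵢ⋆[ℂ] E') (K : F ≃ₗᵢ⋆[ℂ] F') (x y : E ⊗[ℂ] F) :
    inner ℂ (TensorProduct.congr J.toLinearEquiv K.toLinearEquiv x)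
      (TensorProduct.congr J.toLinearEquiv K.toLinearEquiv y) = inner ℂ y x := by
  induction x using TensorProduct.induction_on with
  | zero => simp
  | add x₁ x₂ h₁ h₂ => simp [inner_add_left, inner_add_right, h₁, h₂]
  | tmul a b =>
    induction y using TensorProduct.induction_on with
    | zero => simp
    | add y₁ y₂ h₁ h₂ => simp_all [inner_add_left, inner_add_right]
    | tmul c d =>
      change inner ℂ (J a ⊗ₜ[ℂ] K b) (J c ⊗ₜ[ℂ] K d) = _
      rw [TensorProduct.inner_tmul, TensorProduct.inner_tmul, inner_antiunitary, inner_antiunitary]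

/-- The antiunitary `J ⊗ K` for antiunitaries `J` and `K`. -/
def conjMap (J : E ≃ₗᵢ⋆[ℂ] E') (K : F ≃ₗᵢ⋆[ℂ] F') : HTensor E F ≃ₗᵢ⋆[ℂ] HTensor E' F' :=
  (TensorProduct.congr J.toLinearEquiv K.toLinearEquiv).extendOfIsometry
    (incl E F).toLinearMap (incl E' F').toLinearMap
    (denseRange_incl E F) (denseRange_incl E' F') (fun x => by
      change ‖incl E' F' (TensorProduct.congr J.toLinearEquiv K.toLinearEquiv x)‖ = ‖incl E F x‖
      rw [LinearIsometry.norm_map, LinearIsometry.norm_map, @norm_eq_sqrt_re_inner ℂ,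
        @norm_eq_sqrt_re_inner ℂ, inner_conj_congr])

variable (E F) in
/-- The flip `x ⊗ y ↦ y ⊗ x`. -/
def comm : HTensor E F ≃ₗᵢ[ℂ] HTensor F E :=
  (TensorProduct.commIsometry ℂ E F).toLinearEquiv.extendOfIsometry
    (incl E F).toLinearMap (incl F E).toLinearMap
    (denseRange_incl E F) (denseRange_incl F E) (fun x => by
      change ‖incl F E (TensorProduct.commIsometry ℂ E F x)‖ = ‖incl E F x‖
      simp only [LinearIsometry.norm_map, LinearIsometryEquiv.norm_map])

variable (E F G) in
/-- The isometric embedding of `(E ⊗ F) ⊗ G` into its completion. -/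
def inclLeft : (E ⊗[ℂ] F) ⊗[ℂ] G →ₗᵢ[ℂ] HTensor (HTensor E F) G :=
  (incl (HTensor E F) G).comp (TensorProduct.mapIsometry (incl E F) LinearIsometry.id)

variable (E F G) in
/-- The isometric embedding of `E ⊗ (F ⊗ G)` into its completion. -/
def inclRight : E ⊗[ℂ] (F ⊗[ℂ] G) →ₗᵢ[ℂ] HTensor E (HTensor F G) :=
  (incl E (HTensor F G)).comp (TensorProduct.mapIsometry LinearIsometry.id (incl F G))

theorem denseRange_map {E₁ F₁ E₂ F₂ : Type*}
    [NormedAddCommGroup E₁] [InnerProductSpace ℂ E₁] [NormedAddCommGroup F₁]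
    [InnerProductSpace ℂ F₁] [NormedAddCommGroup E₂] [InnerProductSpace ℂ E₂]
    [NormedAddCommGroup F₂] [InnerProductSpace ℂ F₂]
    (i : E₁ →ₗᵢ[ℂ] E₂) (j : F₁ →ₗᵢ[ℂ] F₂) (hi : DenseRange i) (hj : DenseRange j) :
    DenseRange (TensorProduct.mapIsometry i j) := by
  intro z
  change z ∈ closure (Set.range (TensorProduct.mapIsometry i j))
  have hr : Set.range (TensorProduct.mapIsometry i j)
      = ((LinearMap.range (TensorProduct.mapIsometry i j).toLinearMap : Submodule ℂ _) :
        Set (E₂ ⊗[ℂ] F₂)) := by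
    ext w; simp
  rw [hr, ← Submodule.topologicalClosure_coe, SetLike.mem_coe]
  induction z using TensorProduct.induction_on with
  | zero => exact Submodule.zero_mem _
  | add x y hx hy => exact Submodule.add_mem _ hx hy
  | tmul x y =>
    rw [← SetLike.mem_coe, Submodule.topologicalClosure_coe, ← hr]
    have hd : DenseRange (Prod.map i j) := hi.prodMap hj
    have hc : Continuous fun p : E₂ × F₂ => p.1 ⊗ₜ[ℂ] p.2 := TensorProduct.continuous_tmul
    have hm := map_mem_closure hc (hd (x, y)) (t := Set.range (TensorProduct.mapIsometry i j))
    apply hm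
    rintro _ ⟨⟨a, b⟩, rfl⟩
    exact ⟨a ⊗ₜ[ℂ] b, rfl⟩

variable (E F G) in
theorem denseRange_inclLeft : DenseRange (inclLeft E F G).toLinearMap :=
  (denseRange_incl (HTensor E F) G).comp
    (denseRange_map _ _ (denseRange_incl E F) Function.surjective_id.denseRange)
    (incl (HTensor E F) G).continuous

variable (E F G) in
theorem denseRange_inclRight : DenseRange (inclRight E F G).toLinearMap :=
  (denseRange_incl E (HTensor F G)).comp
    (denseRange_map _ _ Function.surjective_id.denseRange (denseRange_incl F G))
    (incl E (HTensor F G)).continuous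

variable (E F G) in
/-- The associativity unitary `(x ⊗ y) ⊗ z ↦ x ⊗ (y ⊗ z)`. -/
def assoc : HTensor (HTensor E F) G ≃ₗᵢ[ℂ] HTensor E (HTensor F G) :=
  (TensorProduct.assocIsometry ℂ E F G).toLinearEquiv.extendOfIsometry
    (inclLeft E F G).toLinearMap (inclRight E F G).toLinearMap
    (denseRange_inclLeft E F G) (denseRange_inclRight E F G) (fun x => by
      change ‖inclRight E F G (TensorProduct.assocIsometry ℂ E F G x)‖ = ‖inclLeft E F G x‖
      simp only [LinearIsometry.norm_map, LinearIsometryEquiv.norm_map])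

variable (E F G) in
/-- The unitary `(x ⊗ y) ⊗ z ↦ (x ⊗ z) ⊗ y`. -/
def rightComm : HTensor (HTensor E F) G ≃ₗᵢ[ℂ] HTensor (HTensor E G) F :=
  ((assoc E F G).trans (map (LinearIsometryEquiv.refl ℂ E) (comm F G))).trans (assoc E G F).symm

theorem map_tmul (A : E ≃ₗᵢ[ℂ] E') (B : F ≃ₗᵢ[ℂ] F') (x : E) (y : F) :
    map A B (tmul x y) = tmul (A x) (B y) :=
  LinearEquiv.extendOfIsometry_eq _ _ _ _ _ _ (x ⊗ₜ[ℂ] y)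

theorem conjMap_tmul (J : E ≃ₗᵢ⋆[ℂ] E') (K : F ≃ₗᵢ⋆[ℂ] F') (x : E) (y : F) :
    conjMap J K (tmul x y) = tmul (J x) (K y) :=
  LinearEquiv.extendOfIsometry_eq _ _ _ _ _ _ (x ⊗ₜ[ℂ] y)

theorem comm_tmul (x : E) (y : F) : comm E F (tmul x y) = tmul y x :=
  LinearEquiv.extendOfIsometry_eq _ _ _ _ _ _ (x ⊗ₜ[ℂ] y)

theorem assoc_tmul (x : E) (y : F) (z : G) :
    assoc E F G (tmul (tmul x y) z) = tmul x (tmul y z) :=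
  LinearEquiv.extendOfIsometry_eq _ _ _ _ _ _ ((x ⊗ₜ[ℂ] y) ⊗ₜ[ℂ] z)

theorem rightComm_tmul (x : E) (y : F) (z : G) :
    rightComm E F G (tmul (tmul x y) z) = tmul (tmul x z) y := by
  simp only [rightComm, LinearIsometryEquiv.trans_apply, assoc_tmul, map_tmul, comm_tmul,
    LinearIsometryEquiv.coe_refl, id]
  rw [← assoc_tmul, LinearIsometryEquiv.symm_apply_apply]

variable (G) in
/-- `A₁₂ = A ⊗ 1` on `(E ⊗ F) ⊗ G`. -/
def leg12 (A : HTensor E F ≃ₗᵢ[ℂ] HTensor E F) :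
    HTensor (HTensor E F) G ≃ₗᵢ[ℂ] HTensor (HTensor E F) G :=
  map A (LinearIsometryEquiv.refl ℂ G)

variable (F) in
/-- `A₁₃` on `(E ⊗ F) ⊗ G`, for `A` acting on `E ⊗ G`. -/
def leg13 (A : HTensor E G ≃ₗᵢ[ℂ] HTensor E G) :
    HTensor (HTensor E F) G ≃ₗᵢ[ℂ] HTensor (HTensor E F) G :=
  ((rightComm E F G).trans (map A (LinearIsometryEquiv.refl ℂ F))).trans (rightComm E F G).symm

variable (E) in
/-- `A₂₃ = 1 ⊗ A` on `(E ⊗ F) ⊗ G`. -/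
def leg23 (A : HTensor F G ≃ₗᵢ[ℂ] HTensor F G) :
    HTensor (HTensor E F) G ≃ₗᵢ[ℂ] HTensor (HTensor E F) G :=
  ((assoc E F G).trans (map (LinearIsometryEquiv.refl ℂ E) A)).trans (assoc E F G).symm

end HTensor

end Tensor

/-! ### Standard pairs and their modular objects -/

section Standard

variable {𝓗 : Type*} [NormedAddCommGroup 𝓗] [InnerProductSpace ℂ 𝓗] [CompleteSpace 𝓗]

/-- A strongly continuous one-parameter group of unitaries. -/
structure IsUnitaryGroup (U : ℝ → 𝓗 ≃ₗᵢ[ℂ] 𝓗) : Prop where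
  add : ∀ s t, U (s + t) = U s * U t
  continuous : ∀ x, Continuous fun t => U t x

/-- `(H, T)` is a (non-degenerate) standard pair: `T t = exp (i t P)` maps `H` into itself for
`t ≥ 0`, the generator `P` is positive, and `0` is not an eigenvalue of `P`.
The vector `x` lies in the domain of `P` and `P x = y` if and only if
`t ↦ T t x` has derivative `i y` at `0`. -/
structure IsStandardPair (H : StandardSubspace 𝓗) (T : ℝ → 𝓗 ≃ₗᵢ[ℂ] 𝓗) : Prop where
  group : IsUnitaryGroup T
  mapsTo : ∀ t, 0 ≤ t → ∀ f ∈ H.toClosedSubmodule, T t f ∈ H.toClosedSubmodule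
  positive : ∀ x y, HasDerivAt (fun t : ℝ => T t x) (I • y) 0 → 0 ≤ (inner ℂ x y).re
  nondegenerate : ∀ x, HasDerivAt (fun t : ℝ => T t x) 0 0 → x = 0

/-- `J` and `Δ t = Δ_H ^ (i t)` are the modular objects of the standard subspace `H`:
`S = J Δ^{1/2}` is the polar decomposition of the antilinear involution
`S : f + i g ↦ f - i g` with domain `H + i H`.
Here `Δ^{1/2}` is the value at `z = -i/2` of `z ↦ Δ ^ (i z)`: one has `Δ^{1/2} ξ = η`
if and only if the orbit `t ↦ Δ ^ (i t) ξ` extends to a function that is continuous on the strip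
`-1/2 ≤ Im z ≤ 0`, analytic in its interior, and has the value `η` at `-i/2`. -/
structure IsModularPair (H : StandardSubspace 𝓗) (J : 𝓗 ≃ₗᵢ⋆[ℂ] 𝓗)
    (Δ : ℝ → 𝓗 ≃ₗᵢ[ℂ] 𝓗) : Prop where
  involutive : ∀ x, J (J x) = x
  group : IsUnitaryGroup Δ
  polar : ∀ ξ η : 𝓗,
    (∃ f ∈ H.toClosedSubmodule, ∃ g ∈ H.toClosedSubmodule,
      ξ = f + I • g ∧ J η = f - I • g) ↔
    ∃ Φ : ℂ → 𝓗, ContinuousOn Φ {z | -(1 / 2) ≤ z.im ∧ z.im ≤ 0} ∧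
      DifferentiableOn ℂ Φ {z | -(1 / 2) < z.im ∧ z.im < 0} ∧
      (∀ t : ℝ, Φ t = Δ t ξ) ∧ Φ (-(I / 2)) = η

/-- The unitary `V : 𝓗 → L²(ℝ, ℂ^ι)` is a parametrization of the standard pair with translations
`T` and modular objects `J`, `Δ`, of finite multiplicity `|ι|`: with `P` the generator of `T`,
the operator `Q = ln P` acts as multiplication by the variable `q`, `Δ ^ (i t)` as translation by
`2 π t`, and `J` as complex conjugation combined with the involution `α ↦ ᾱ` of the index set. -/
structure IsParametrization {ι : Type*} [Fintype ι] (bar : ι → ι)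
    (T : ℝ → 𝓗 ≃ₗᵢ[ℂ] 𝓗) (J : 𝓗 ≃ₗᵢ⋆[ℂ] 𝓗) (Δ : ℝ → 𝓗 ≃ₗᵢ[ℂ] 𝓗)
    (V : 𝓗 ≃ₗᵢ[ℂ] Lp (EuclideanSpace ℂ ι) 2 (volume : Measure ℝ)) : Prop where
  bar_involutive : Function.Involutive bar
  translation : ∀ (t : ℝ) (f : 𝓗),
    ∀ᵐ q : ℝ, V (T t f) q = Complex.exp (I * (t * Real.exp q : ℝ)) • V f q
  dilation : ∀ (t : ℝ) (f : 𝓗), ∀ᵐ q : ℝ, V (Δ t f) q = V f (q - 2 * Real.pi * t)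
  conjugation : ∀ f : 𝓗, ∀ᵐ q : ℝ, ∀ α, V (J f) q α = conj (V f q (bar α))

/-! ### Scattering operators -/

/-- The set `𝒮(H, T)` of two-particle scattering operators of a standard pair `(H, T)`,
whose modular objects are `J` and `Δ`. -/
structure IsScatteringOperator (H : StandardSubspace 𝓗) (T : ℝ → 𝓗 ≃ₗᵢ[ℂ] 𝓗)
    (J : 𝓗 ≃ₗᵢ⋆[ℂ] 𝓗) (Δ : ℝ → 𝓗 ≃ₗᵢ[ℂ] 𝓗)
    (R : HTensor 𝓗 𝓗 ≃ₗᵢ[ℂ] HTensor 𝓗 𝓗) : Prop where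
  reflection : HTensor.comm 𝓗 𝓗 * R * HTensor.comm 𝓗 𝓗 = R⁻¹
  yangBaxter : HTensor.leg12 𝓗 R * HTensor.leg13 𝓗 R * HTensor.leg23 𝓗 R
    = HTensor.leg23 𝓗 R * HTensor.leg13 𝓗 R * HTensor.leg12 𝓗 R
  translation : ∀ t₁ t₂ : ℝ, Commute R (HTensor.map (T t₁) (T t₂))
  dilation : ∀ t : ℝ, Commute R (HTensor.map (Δ t) (Δ t))
  tcp : ∀ x, R (HTensor.conjMap J J x) = HTensor.conjMap J J (R⁻¹ x)
  locality : ∀ f ∈ H.toClosedSubmodule, ∀ g ∈ H.symplComp.toClosedSubmodule, ∀ ξ η : 𝓗,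
    inner ℂ (HTensor.tmul g η) (R (HTensor.tmul f ξ))
      = inner ℂ (HTensor.tmul f η) (R⁻¹ (HTensor.tmul g ξ))

/-- The set `𝒮(R⁺, R⁻)` of left-right scattering operators for two standard pairs
`(H₊, T₊)` and `(H₋, T₋)` with modular groups `Δ₊` and `Δ₋`. -/
structure IsLeftRightScattering {𝓚 : Type*} [NormedAddCommGroup 𝓚] [InnerProductSpace ℂ 𝓚]
    [CompleteSpace 𝓚]
    (Hp : StandardSubspace 𝓗) (Tp Δp : ℝ → 𝓗 ≃ₗᵢ[ℂ] 𝓗) (Rp : HTensor 𝓗 𝓗 ≃ₗᵢ[ℂ] HTensor 𝓗 𝓗)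
    (Hm : StandardSubspace 𝓚) (Tm Δm : ℝ → 𝓚 ≃ₗᵢ[ℂ] 𝓚) (Rm : HTensor 𝓚 𝓚 ≃ₗᵢ[ℂ] HTensor 𝓚 𝓚)
    (S : HTensor 𝓗 𝓚 ≃ₗᵢ[ℂ] HTensor 𝓗 𝓚) : Prop where
  boost : ∀ t : ℝ, Commute S (HTensor.map (Δp t) (Δm (-t)))
  translation : ∀ t₁ t₂ : ℝ, Commute S (HTensor.map (Tp t₁) (Tm t₂))
  /-- On `𝓗 ⊗ 𝓗 ⊗ 𝓚`. -/
  leftYangBaxter : HTensor.leg12 𝓚 Rp * HTensor.leg13 𝓗 S * HTensor.leg23 𝓗 S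
    = HTensor.leg23 𝓗 S * HTensor.leg13 𝓗 S * HTensor.leg12 𝓚 Rp
  /-- On `𝓗 ⊗ 𝓚 ⊗ 𝓚`. The order of the factors is the one for which `S₁₂ S₁₃` commutes with
  the `R⁻`-permutation `F₂₃ R⁻₂₃`, as the left equation says that `S₁₃ S₂₃` commutes
  with `F₁₂ R⁺₁₂`. -/
  rightYangBaxter : HTensor.leg23 𝓗 Rm * HTensor.leg12 𝓚 S * HTensor.leg13 𝓚 S
    = HTensor.leg13 𝓚 S * HTensor.leg12 𝓚 S * HTensor.leg23 𝓗 Rm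
  leftLocality : ∀ f ∈ Hp.toClosedSubmodule, ∀ g ∈ Hp.symplComp.toClosedSubmodule, ∀ ξ η : 𝓚,
    inner ℂ (HTensor.tmul g η) (S (HTensor.tmul f ξ))
      = inner ℂ (HTensor.tmul f η) (S⁻¹ (HTensor.tmul g ξ))
  rightLocality : ∀ f ∈ Hm.toClosedSubmodule, ∀ g ∈ Hm.symplComp.toClosedSubmodule, ∀ ξ η : 𝓗,
    inner ℂ (HTensor.tmul η g) (S (HTensor.tmul ξ f))
      = inner ℂ (HTensor.tmul η f) (S⁻¹ (HTensor.tmul ξ g))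

/-- The unitary `A` on `𝓗 ⊗ 𝓗` is given, in the parametrization `V`, by the (almost everywhere
unitary) matrix-valued function `M` of the variable `s q₁ q₂`:
`(A x)^{αβ}(q₁, q₂) = ∑ γ δ, M^{αβ}_{γδ}(s q₁ q₂) x^{γδ}(q₁, q₂)`,
expressed through the matrix elements of `A` between elementary tensors. With
`s q₁ q₂ = q₁ - q₂` this says `A = M(Q ⊗ 1 - 1 ⊗ Q)`, and with `s q₁ q₂ = q₁ + q₂` it says
`A = M(Q ⊗ 1 + 1 ⊗ Q)`. -/
structure HasMatrixFunction {ι : Type*} [Fintype ι] [DecidableEq ι]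
    (V : 𝓗 ≃ₗᵢ[ℂ] Lp (EuclideanSpace ℂ ι) 2 (volume : Measure ℝ)) (s : ℝ → ℝ → ℝ)
    (A : HTensor 𝓗 𝓗 ≃ₗᵢ[ℂ] HTensor 𝓗 𝓗) (M : ℝ → Matrix (ι × ι) (ι × ι) ℂ) : Prop where
  measurable : ∀ i j, Measurable fun q => M q i j
  unitary : ∀ᵐ q : ℝ, M q ∈ Matrix.unitaryGroup (ι × ι) ℂ
  matrixElement : ∀ f g h k : 𝓗,
    inner ℂ (HTensor.tmul h k) (A (HTensor.tmul f g))
      = ∫ p : ℝ × ℝ, ∑ α, ∑ β, ∑ γ, ∑ δ,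
          conj (V h p.1 α * V k p.2 β) *
            (M (s p.1 p.2) (α, β) (γ, δ) * (V f p.1 γ * V g p.2 δ))

/-- Flip symmetry of a matrix-valued function: `F M(q) F = M(q)` for almost every `q`, where `F`
is the flip of `ℂ^ι ⊗ ℂ^ι`. -/
def IsFlipSymmetric {ι : Type*} (M : ℝ → Matrix (ι × ι) (ι × ι) ℂ) : Prop :=
  ∀ᵐ q : ℝ, ∀ α β γ δ, M q (α, β) (γ, δ) = M q (β, α) (δ, γ)

end Standard

end

/-! Left-right scattering comes from ordinary scattering by reversing one rapidity. Let `Π` be the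
reflection `q ↦ -q`, transported to `𝓗` by `V`. The substitution `q₂ ↦ -q₂` shows that `S = (1 ⊗ Π)
R (1 ⊗ Π)` is the operator with matrix function of `q₁ + q₂` (`HasMatrixFunction.paritySnd_conj`),
so `S` exists as a unitary; matrix elements on elementary tensors make it unique. Since `Π` reverses
rapidity translations, invariance of `R` under `Δ t ⊗ Δ t` becomes invariance of `S` under `Δ t ⊗ Δ
(-t)`. Left locality is inherited because `Π` acts only on the arbitrary vectors `ξ`, `η`.
Conjugating the Yang–Baxter equation of `R` by `Π` on the third leg gives the left mixed equation,
as `R₁₂` is unaffected.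

Flip symmetry together with `R₂₁ = R⁻¹` yields a second description, `S = (Π ⊗ 1) R⁻¹ (Π ⊗ 1)`. From
it the right mixed equation follows by conjugating a rearranged Yang–Baxter equation on the first
leg. Right locality is left locality transported by the flip, which fixes `S`.

That `R` has a matrix function at all is a direct-integral argument. Since `R` commutes with all `T
t₁ ⊗ T t₂`, and the characters of `(e^{q₁}, e^{q₂})` separate integrable functions
(`ae_eq_zero_of_integral_expChar`), its matrix elements can be compared pointwise
(`ae_inner_eq_of_commute`). Testing against nowhere vanishing Gaussian vectors extracts a unitary
matrix `N(q₁, q₂)` (`exists_matrixFunction`). Dilation covariance makes `N` invariant under diagonal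
translations, hence by Fubini a function of `q₁ - q₂` (`exists_ae_eq_sub`). -/

noncomputable section

/-! ### Density of elementary tensors and the algebra of leg operators. -/

namespace HTensor

variable {E F G X : Type*}
  [NormedAddCommGroup E] [InnerProductSpace ℂ E]
  [NormedAddCommGroup F] [InnerProductSpace ℂ F]
  [NormedAddCommGroup G] [InnerProductSpace ℂ G]
  [NormedAddCommGroup X] [InnerProductSpace ℂ X]

theorem tmul_add_left (x x' : E) (y : F) : tmul (x + x') y = tmul x y + tmul x' y := by
  simp only [← incl_tmul, TensorProduct.add_tmul, map_add]

theorem tmul_smul_left (c : ℂ) (x : E) (y : F) : tmul (c • x) y = c • tmul x y := by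
  simp only [← incl_tmul, ← TensorProduct.smul_tmul', map_smul]

/-- The continuous linear map `x ↦ x ⊗ y`. -/
def tmulRight (y : F) : E →L[ℂ] HTensor E F :=
  { toFun := fun x => tmul x y
    map_add' := fun x x' => tmul_add_left x x' y
    map_smul' := fun c x => tmul_smul_left c x y
    cont := (UniformSpace.Completion.continuous_coe _).comp
      (TensorProduct.continuous_tmul.comp (continuous_id.prodMk continuous_const)) }

/-- Continuous linear maps on a Hilbert tensor product agree if they agree on elementary tensors. -/
theorem ext_clm {A B : HTensor E F →L[ℂ] X} (h : ∀ x y, A (tmul x y) = B (tmul x y)) : A = B := by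
  have hd := denseRange_incl E F
  refine ContinuousLinearMap.coeFn_injective (hd.equalizer A.continuous B.continuous ?_)
  funext u
  change A (incl E F u) = B (incl E F u)
  induction u using TensorProduct.induction_on with
  | zero => simp
  | add x y hx hy => simp only [map_add, hx, hy]
  | tmul x y => exact h x y

theorem ext_equiv {A B : HTensor E F ≃ₗᵢ[ℂ] X} (h : ∀ x y, A (tmul x y) = B (tmul x y)) :
    A = B := by
  have := ext_clm (A := (A.toContinuousLinearEquiv : HTensor E F →L[ℂ] X))
    (B := (B.toContinuousLinearEquiv : HTensor E F →L[ℂ] X)) h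
  exact LinearIsometryEquiv.ext fun x => congrArg (fun L : HTensor E F →L[ℂ] X => L x) this

theorem ext_equiv₃ {A B : HTensor (HTensor E F) G ≃ₗᵢ[ℂ] X}
    (h : ∀ x y z, A (tmul (tmul x y) z) = B (tmul (tmul x y) z)) : A = B := by
  refine ext_equiv fun u z => ?_
  have := ext_clm
    (A := (A.toContinuousLinearEquiv : HTensor (HTensor E F) G →L[ℂ] X).comp (tmulRight z))
    (B := (B.toContinuousLinearEquiv : HTensor (HTensor E F) G →L[ℂ] X).comp (tmulRight z))
    (fun x y => h x y z)
  exact congrArg (fun L : HTensor E F →L[ℂ] X => L u) this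

/-- A vector of a Hilbert tensor product is determined by its inner products with elementary
tensors. -/
theorem ext_inner {u v : HTensor E F}
    (h : ∀ x y, inner ℂ (tmul x y) u = inner ℂ (tmul x y) v) : u = v := by
  refine ext_inner_right ℂ fun w => ?_
  have := ext_clm (A := innerSL ℂ u) (B := innerSL ℂ v) (fun x y => by
    rw [innerSL_apply_apply, innerSL_apply_apply, ← inner_conj_symm, h, inner_conj_symm])
  exact congrArg (fun L : HTensor E F →L[ℂ] ℂ => L w) this

theorem ext_matrixElement {A B : HTensor E F ≃ₗᵢ[ℂ] HTensor E F}
    (h : ∀ x y x' y', inner ℂ (tmul x' y') (A (tmul x y)) = inner ℂ (tmul x' y') (B (tmul x y))) :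
    A = B :=
  ext_equiv fun x y => ext_inner fun x' y' => h x y x' y'

theorem map_mul (A A' : E ≃ₗᵢ[ℂ] E) (B B' : F ≃ₗᵢ[ℂ] F) :
    map (A * A') (B * B') = map A B * map A' B' :=
  ext_equiv fun x y => by simp [map_tmul]

theorem map_one : map (1 : E ≃ₗᵢ[ℂ] E) (1 : F ≃ₗᵢ[ℂ] F) = 1 :=
  ext_equiv fun x y => by simp [map_tmul]

theorem comm_mul_comm : comm E E * comm E E = 1 :=
  ext_equiv fun x y => by simp [comm_tmul]

theorem comm_mul_map (A B : E ≃ₗᵢ[ℂ] E) : comm E E * map A B = map B A * comm E E :=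
  ext_equiv fun x y => by simp [comm_tmul, map_tmul]

theorem assoc_symm_tmul (x : E) (y : F) (z : G) :
    (assoc E F G).symm (tmul x (tmul y z)) = tmul (tmul x y) z := by
  rw [← assoc_tmul, LinearIsometryEquiv.symm_apply_apply]

theorem rightComm_symm_tmul (x : E) (y : F) (z : G) :
    (rightComm E F G).symm (tmul (tmul x z) y) = tmul (tmul x y) z := by
  rw [← rightComm_tmul, LinearIsometryEquiv.symm_apply_apply]

theorem leg12_mul (A B : HTensor E F ≃ₗᵢ[ℂ] HTensor E F) :
    leg12 G (A * B) = leg12 G A * leg12 G B := by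
  rw [leg12, leg12, leg12, ← map_mul]; rfl

theorem leg13_mul (A B : HTensor E G ≃ₗᵢ[ℂ] HTensor E G) :
    leg13 F (A * B) = leg13 F A * leg13 F B := by
  have := map_mul A B (1 : F ≃ₗᵢ[ℂ] F) 1
  ext1 x
  have h := congrArg (fun L => L (rightComm E F G x)) this
  simp only [leg13, LinearIsometryEquiv.trans_apply, LinearIsometryEquiv.coe_mul,
    Function.comp_apply, LinearIsometryEquiv.apply_symm_apply] at h ⊢
  exact congrArg _ h

theorem leg23_mul (A B : HTensor F G ≃ₗᵢ[ℂ] HTensor F G) :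
    leg23 E (A * B) = leg23 E A * leg23 E B := by
  have := map_mul (1 : E ≃ₗᵢ[ℂ] E) 1 A B
  ext1 x
  have h := congrArg (fun L => L (assoc E F G x)) this
  simp only [leg23, LinearIsometryEquiv.trans_apply, LinearIsometryEquiv.coe_mul,
    Function.comp_apply, LinearIsometryEquiv.apply_symm_apply] at h ⊢
  exact congrArg _ h

theorem leg12_inv (A : HTensor E F ≃ₗᵢ[ℂ] HTensor E F) : leg12 G A⁻¹ = (leg12 G A)⁻¹ :=
  (MonoidHom.mk' (leg12 G) leg12_mul).map_inv A

theorem leg13_inv (A : HTensor E G ≃ₗᵢ[ℂ] HTensor E G) : leg13 F A⁻¹ = (leg13 F A)⁻¹ :=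
  (MonoidHom.mk' (leg13 F) leg13_mul).map_inv A

theorem leg13_map_one (A : E ≃ₗᵢ[ℂ] E) :
    leg13 F (map A (1 : G ≃ₗᵢ[ℂ] G)) = map (map A 1) 1 :=
  ext_equiv₃ fun x y z => by
    simp [leg13, rightComm_tmul, rightComm_symm_tmul, map_tmul]

theorem leg13_one_map (B : G ≃ₗᵢ[ℂ] G) : leg13 F (map (1 : E ≃ₗᵢ[ℂ] E) B) = map 1 B :=
  ext_equiv₃ fun x y z => by
    simp [leg13, rightComm_tmul, rightComm_symm_tmul, map_tmul]

theorem leg23_one_map (B : G ≃ₗᵢ[ℂ] G) : leg23 E (map (1 : F ≃ₗᵢ[ℂ] F) B) = map 1 B :=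
  ext_equiv₃ fun x y z => by
    simp [leg23, assoc_tmul, assoc_symm_tmul, map_tmul]

theorem commute_leg12 (A : HTensor E F ≃ₗᵢ[ℂ] HTensor E F) (B : G ≃ₗᵢ[ℂ] G) :
    Commute (leg12 G A) (map 1 B) := by
  change map A 1 * map 1 B = map 1 B * map A 1
  rw [← map_mul, ← map_mul, one_mul, mul_one, one_mul, mul_one]

theorem commute_leg23 (A : HTensor F G ≃ₗᵢ[ℂ] HTensor F G) (B : E ≃ₗᵢ[ℂ] E) :
    Commute (leg23 E A) (map (map B 1) 1) := by
  have h₁ : map (map B (1 : F ≃ₗᵢ[ℂ] F)) (1 : G ≃ₗᵢ[ℂ] G)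
      = ((assoc E F G).trans (map B 1)).trans (assoc E F G).symm :=
    ext_equiv₃ fun x y z => by simp [assoc_tmul, assoc_symm_tmul, map_tmul]
  have h₂ : map 1 A * map B 1 = map B 1 * map 1 A := by
    rw [← map_mul, ← map_mul, one_mul, mul_one, one_mul, mul_one]
  rw [h₁]
  ext1 x
  have h := congrArg (fun L => L (assoc E F G x)) h₂
  simp only [leg23, LinearIsometryEquiv.trans_apply, LinearIsometryEquiv.coe_mul,
    Function.comp_apply, LinearIsometryEquiv.apply_symm_apply] at h ⊢
  exact congrArg _ h

end HTensor

/-! ### Null sets of the plane under coordinate maps. -/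

theorem ae_fst {p : ℝ → Prop} (h : ∀ᵐ q : ℝ, p q) : ∀ᵐ q : ℝ × ℝ, p q.1 :=
  (Measure.quasiMeasurePreserving_fst (μ := (volume : Measure ℝ)) (ν := volume)).ae h

theorem ae_snd {p : ℝ → Prop} (h : ∀ᵐ q : ℝ, p q) : ∀ᵐ q : ℝ × ℝ, p q.2 :=
  (Measure.quasiMeasurePreserving_snd (μ := (volume : Measure ℝ)) (ν := volume)).ae h

theorem measurePreserving_sub_snd :
    MeasurePreserving (fun q : ℝ × ℝ => (q.1 - q.2, q.2)) := by
  have h := measurePreserving_sub_prod (volume : Measure ℝ) (volume : Measure ℝ)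
  exact h

theorem measurePreserving_neg_snd :
    MeasurePreserving (fun q : ℝ × ℝ => (q.1, -q.2)) :=
  (MeasurePreserving.id (volume : Measure ℝ)).prod (Measure.measurePreserving_neg volume)

/-- The difference is the first coordinate after a measure preserving shear. -/
theorem ae_sub {p : ℝ → Prop} (h : ∀ᵐ q : ℝ, p q) : ∀ᵐ q : ℝ × ℝ, p (q.1 - q.2) :=
  measurePreserving_sub_snd.quasiMeasurePreserving.ae (ae_fst h)

theorem ae_add {p : ℝ → Prop} (h : ∀ᵐ q : ℝ, p q) : ∀ᵐ q : ℝ × ℝ, p (q.1 + q.2) := by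
  simpa using measurePreserving_neg_snd.quasiMeasurePreserving.ae (ae_sub h)

/-! ### The rapidity reflection on one-particle space. -/

section Parity

variable {𝓗 : Type*} [NormedAddCommGroup 𝓗] [InnerProductSpace ℂ 𝓗]
  {K : Type*} [NormedAddCommGroup K] [InnerProductSpace ℂ K]

variable (K) in
/-- The reflection `f ↦ f (-·)` on `L²(ℝ, K)`. -/
def lpReflection : Lp K 2 (volume : Measure ℝ) ≃ₗᵢ[ℂ] Lp K 2 (volume : Measure ℝ) :=
  let L := Lp.compMeasurePreservingₗᵢ ℂ (E := K) (p := 2) (Neg.neg : ℝ → ℝ)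
    (Measure.measurePreserving_neg volume)
  { LinearEquiv.ofInvolutive L.toLinearMap (fun f => by
      change Lp.compMeasurePreserving _ _ (Lp.compMeasurePreserving _ _ f) = f
      rw [← Lp.compMeasurePreserving_comp_apply]
      simp only [neg_comp_neg]
      exact Lp.compMeasurePreserving_id_apply f) with
    norm_map' := L.norm_map }

theorem lpReflection_lpReflection (f : Lp K 2 (volume : Measure ℝ)) :
    lpReflection K (lpReflection K f) = f :=
  (lpReflection K).toLinearEquiv.symm_apply_apply f

theorem coeFn_lpReflection (f : Lp K 2 (volume : Measure ℝ)) :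
    ∀ᵐ q : ℝ, lpReflection K f q = f (-q) :=
  Lp.coeFn_compMeasurePreserving f (Measure.measurePreserving_neg volume)

/-- The reflection `q ↦ -q` transported by a unitary onto `L²(ℝ, K)`. -/
def parity (V : 𝓗 ≃ₗᵢ[ℂ] Lp K 2 (volume : Measure ℝ)) : 𝓗 ≃ₗᵢ[ℂ] 𝓗 :=
  (V.trans (lpReflection K)).trans V.symm

variable (V : 𝓗 ≃ₗᵢ[ℂ] Lp K 2 (volume : Measure ℝ))

theorem parity_mul_parity : parity V * parity V = 1 := by
  ext1 x
  simp [parity, lpReflection_lpReflection]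

theorem coeFn_parity (f : 𝓗) : ∀ᵐ q : ℝ, V (parity V f) q = V f (-q) := by
  simpa [parity] using coeFn_lpReflection (V f)

/-- Reflection reverses translations; this is what later changes `Δ t` into `Δ (-t)` in the second
factor. -/
theorem mul_parity_of_translation {U U' : 𝓗 ≃ₗᵢ[ℂ] 𝓗} {s : ℝ}
    (hU : ∀ f, ∀ᵐ q : ℝ, V (U f) q = V f (q - s)) (hU' : ∀ f, ∀ᵐ q : ℝ, V (U' f) q = V f (q + s)) :
    parity V * U' = U * parity V := by
  ext1 f
  apply V.injective
  apply Lp.ext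
  have h₁ := (Measure.measurePreserving_neg (volume : Measure ℝ)).quasiMeasurePreserving.ae (hU' f)
  have h₂ := (measurePreserving_sub_right (volume : Measure ℝ) s).quasiMeasurePreserving.ae
    (coeFn_parity V f)
  filter_upwards [coeFn_parity V (U' f), hU (parity V f), h₁, h₂] with q a b c d
  rw [LinearIsometryEquiv.coe_mul, LinearIsometryEquiv.coe_mul, Function.comp_apply,
    Function.comp_apply, a, b, c, d]
  ring_nf

end Parity

/-! ### Operators given by matrix functions, under reflection and flip. -/

section MatrixFunction

variable {𝓗 : Type*} [NormedAddCommGroup 𝓗] [InnerProductSpace ℂ 𝓗]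
  {ι : Type*} [Fintype ι]
  {V : 𝓗 ≃ₗᵢ[ℂ] Lp (EuclideanSpace ℂ ι) 2 (volume : Measure ℝ)}
  {A B : HTensor 𝓗 𝓗 ≃ₗᵢ[ℂ] HTensor 𝓗 𝓗} {M : ℝ → Matrix (ι × ι) (ι × ι) ℂ} {s : ℝ → ℝ → ℝ}

/-- The operator `1 ⊗ Π` with `Π` the parity operator. -/
abbrev paritySnd (V : 𝓗 ≃ₗᵢ[ℂ] Lp (EuclideanSpace ℂ ι) 2 (volume : Measure ℝ)) :
    HTensor 𝓗 𝓗 ≃ₗᵢ[ℂ] HTensor 𝓗 𝓗 := HTensor.map 1 (parity V)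

theorem paritySnd_mul_self : paritySnd V * paritySnd V = 1 := by
  rw [← HTensor.map_mul, parity_mul_parity, one_mul, HTensor.map_one]

theorem eq_inv_of_mul_self {G : Type*} [Group G] {p : G} (h : p * p = 1) : p⁻¹ = p :=
  inv_eq_of_mul_eq_one_right h

theorem inner_involution_right {K : Type*} [NormedAddCommGroup K] [InnerProductSpace ℂ K]
    {P : K ≃ₗᵢ[ℂ] K} (hP : P * P = 1) (x y : K) : inner ℂ x (P y) = inner ℂ (P x) y := by
  rw [← P.inner_map_map x]
  change inner ℂ (P x) ((P * P) y) = _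
  rw [hP]; rfl

variable [DecidableEq ι]

theorem HasMatrixFunction.eq (hA : HasMatrixFunction V s A M) (hB : HasMatrixFunction V s B M) :
    A = B :=
  HTensor.ext_matrixElement fun f g h k => by rw [hA.matrixElement, hB.matrixElement]

/-- Substituting `q₂ ↦ -q₂` in the integral turns the difference into the sum. This provides the
operator `S`. -/
theorem HasMatrixFunction.paritySnd_conj (hA : HasMatrixFunction V (fun q₁ q₂ => q₁ - q₂) A M) :
    HasMatrixFunction V (fun q₁ q₂ => q₁ + q₂) (paritySnd V * A * paritySnd V) M where
  measurable := hA.measurable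
  unitary := hA.unitary
  matrixElement f g h k := by
    simp only [LinearIsometryEquiv.coe_mul, Function.comp_apply]
    rw [inner_involution_right paritySnd_mul_self, HTensor.map_tmul, HTensor.map_tmul,
      LinearIsometryEquiv.coe_one, id, id, hA.matrixElement]
    rw [← measurePreserving_neg_snd.integral_comp
      ((MeasurableEquiv.refl ℝ).prodCongr (MeasurableEquiv.neg ℝ)).measurableEmbedding]
    refine integral_congr_ae ?_
    have h₁ := measurePreserving_neg_snd.quasiMeasurePreserving.ae (ae_snd (coeFn_parity V g))
    have h₂ := measurePreserving_neg_snd.quasiMeasurePreserving.ae (ae_snd (coeFn_parity V k))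
    filter_upwards [h₁, h₂] with p a b
    simp only [a, b, neg_neg, sub_neg_eq_add]

/-- The variable `q₁ + q₂` is unchanged by exchanging coordinates, so the flip acts only on the
matrix indices, where the assumed symmetry absorbs it. -/
theorem HasMatrixFunction.comm_conj (hA : HasMatrixFunction V (fun q₁ q₂ => q₁ + q₂) A M)
    (hM : IsFlipSymmetric M) :
    HTensor.comm 𝓗 𝓗 * A * HTensor.comm 𝓗 𝓗 = A := by
  refine HTensor.ext_matrixElement fun f g h k => ?_
  simp only [LinearIsometryEquiv.coe_mul, Function.comp_apply]
  rw [inner_involution_right HTensor.comm_mul_comm, HTensor.comm_tmul, HTensor.comm_tmul,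
    hA.matrixElement, hA.matrixElement]
  have hs : MeasurePreserving (Prod.swap : ℝ × ℝ → ℝ × ℝ) :=
    Measure.measurePreserving_swap (μ := (volume : Measure ℝ)) (ν := (volume : Measure ℝ))
  rw [← hs.integral_comp MeasurableEquiv.prodComm.measurableEmbedding]
  refine integral_congr_ae ?_
  filter_upwards [ae_add hM] with p hp
  simp only [Prod.fst_swap, Prod.snd_swap]
  rw [Finset.sum_comm]
  refine Finset.sum_congr rfl fun α _ => Finset.sum_congr rfl fun β _ => ?_
  rw [Finset.sum_comm]
  refine Finset.sum_congr rfl fun γ _ => Finset.sum_congr rfl fun δ _ => ?_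
  rw [hp, add_comm p.2 p.1, mul_comm (V k p.2 β), mul_comm (V g p.2 δ)]

/-- Scalar phases in each variable commute with fibrewise matrix multiplication, whatever the
argument `s` of the matrix function. -/
theorem HasMatrixFunction.commute_map (hA : HasMatrixFunction V s A M)
    {U₁ U₂ : 𝓗 ≃ₗᵢ[ℂ] 𝓗} {u₁ u₂ : ℝ → ℂ}
    (hu₁ : ∀ q, conj (u₁ q) * u₁ q = 1) (hu₂ : ∀ q, conj (u₂ q) * u₂ q = 1)
    (hU₁ : ∀ f, ∀ᵐ q : ℝ, V (U₁ f) q = u₁ q • V f q)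
    (hU₂ : ∀ f, ∀ᵐ q : ℝ, V (U₂ f) q = u₂ q • V f q) :
    Commute A (HTensor.map U₁ U₂) := by
  refine HTensor.ext_matrixElement fun f g h k => ?_
  -- With the test vectors written as images, one side loses `U₁ ⊗ U₂` by unitarity, while on the
  -- other the phases cancel pointwise.
  obtain ⟨h, rfl⟩ := U₁.surjective h
  obtain ⟨k, rfl⟩ := U₂.surjective k
  simp only [LinearIsometryEquiv.coe_mul, Function.comp_apply]
  rw [HTensor.map_tmul, ← HTensor.map_tmul U₁ U₂ h k, LinearIsometryEquiv.inner_map_map,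
    HTensor.map_tmul, hA.matrixElement, hA.matrixElement]
  refine integral_congr_ae ?_
  filter_upwards [ae_fst (hU₁ f), ae_fst (hU₁ h), ae_snd (hU₂ g), ae_snd (hU₂ k)] with p a b c d
  refine Finset.sum_congr rfl fun α _ => Finset.sum_congr rfl fun β _ =>
    Finset.sum_congr rfl fun γ _ => Finset.sum_congr rfl fun δ _ => ?_
  simp only [a, b, c, d, PiLp.smul_apply, smul_eq_mul, _root_.map_mul]
  linear_combination (conj (u₂ p.2) * u₂ p.2 * (conj (V h p.1 α) * conj (V k p.2 β) *
      (M (s p.1 p.2) (α, β) (γ, δ) * (V f p.1 γ * V g p.2 δ)))) * hu₁ p.1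
    + (conj (V h p.1 α) * conj (V k p.2 β) *
      (M (s p.1 p.2) (α, β) (γ, δ) * (V f p.1 γ * V g p.2 δ))) * hu₂ p.2

end MatrixFunction

/-! ### Deriving the left-right scattering axioms. -/

section LeftRight

/-- Conjugate the whole equation by the involution `p`; the factor `a` is fixed because it commutes
with `p`. -/
theorem conj_yangBaxter_left {G : Type*} [Group G] {a b c p : G} (hp : p * p = 1)
    (ha : Commute a p) (h : a * b * c = c * b * a) :
    a * (p * b * p) * (p * c * p) = p * c * p * (p * b * p) * a := by
  have h₁ : ∀ x y : G, p * x * p * (p * y * p) = p * (x * y) * p := fun x y => by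
    calc p * x * p * (p * y * p) = p * x * (p * p) * y * p := by group
      _ = _ := by rw [hp]; group
  have h₂ : a = p * a * p := by rw [← ha.eq, mul_assoc, hp, mul_one]
  calc a * (p * b * p) * (p * c * p) = p * a * p * (p * b * p) * (p * c * p) := by rw [← h₂]
    _ = p * c * p * (p * b * p) * (p * a * p) := by rw [h₁, h₁, h₁, h₁, h]
    _ = _ := by rw [← h₂]

/-- Multiplying the hypothesis by `b⁻¹ a⁻¹` on the left and `a⁻¹ b⁻¹` on the right gives `c a⁻¹ b⁻¹
= b⁻¹ a⁻¹ c`, to which the left version applies with `c` as the fixed factor. -/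
theorem conj_yangBaxter_right {G : Type*} [Group G] {a b c p : G} (hp : p * p = 1)
    (hc : Commute c p) (h : a * b * c = c * b * a) :
    c * (p * a⁻¹ * p) * (p * b⁻¹ * p) = p * b⁻¹ * p * (p * a⁻¹ * p) * c := by
  refine conj_yangBaxter_left hp hc ?_
  calc c * a⁻¹ * b⁻¹ = b⁻¹ * a⁻¹ * (a * b * c) * a⁻¹ * b⁻¹ := by group
    _ = b⁻¹ * a⁻¹ * (c * b * a) * a⁻¹ * b⁻¹ := by rw [h]
    _ = _ := by group

theorem conj_exp_I_mul_exp_I (r : ℝ) : conj (Complex.exp (I * r)) * Complex.exp (I * r) = 1 := by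
  rw [← Complex.exp_conj, ← Complex.exp_add, map_mul, conj_I, conj_ofReal, neg_mul,
    neg_add_cancel, Complex.exp_zero]

variable {𝓗 : Type*} [NormedAddCommGroup 𝓗] [InnerProductSpace ℂ 𝓗]
  {ι : Type*} [Fintype ι]
  {V : 𝓗 ≃ₗᵢ[ℂ] Lp (EuclideanSpace ℂ ι) 2 (volume : Measure ℝ)}
  {R : HTensor 𝓗 𝓗 ≃ₗᵢ[ℂ] HTensor 𝓗 𝓗}

open HTensor in
-- Both `1 ⊗ Π` on legs 13 and on legs 23 are `Π` on the third leg, which commutes with `R₁₂`.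
theorem yangBaxter_paritySnd_conj
    (V : 𝓗 ≃ₗᵢ[ℂ] Lp (EuclideanSpace ℂ ι) 2 (volume : Measure ℝ))
    (h : leg12 𝓗 R * leg13 𝓗 R * leg23 𝓗 R = leg23 𝓗 R * leg13 𝓗 R * leg12 𝓗 R) :
    leg12 𝓗 R * leg13 𝓗 (paritySnd V * R * paritySnd V) * leg23 𝓗 (paritySnd V * R * paritySnd V)
      = leg23 𝓗 (paritySnd V * R * paritySnd V) * leg13 𝓗 (paritySnd V * R * paritySnd V)
        * leg12 𝓗 R := by
  have hp : HTensor.map (1 : HTensor 𝓗 𝓗 ≃ₗᵢ[ℂ] HTensor 𝓗 𝓗) (parity V)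
      * HTensor.map 1 (parity V) = 1 := by
    rw [← HTensor.map_mul, parity_mul_parity, one_mul, HTensor.map_one]
  have h₁ : leg13 𝓗 (paritySnd V) = HTensor.map 1 (parity V) := leg13_one_map _
  have h₂ : leg23 𝓗 (paritySnd V) = HTensor.map 1 (parity V) := leg23_one_map _
  simp only [leg13_mul, leg23_mul, h₁, h₂]
  exact conj_yangBaxter_left hp (commute_leg12 R (parity V)) h

/-- The operator `Π ⊗ 1` with `Π` the parity operator. -/
abbrev parityFst (V : 𝓗 ≃ₗᵢ[ℂ] Lp (EuclideanSpace ℂ ι) 2 (volume : Measure ℝ)) :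
    HTensor 𝓗 𝓗 ≃ₗᵢ[ℂ] HTensor 𝓗 𝓗 := HTensor.map (parity V) 1

theorem parityFst_mul_self : parityFst V * parityFst V = 1 := by
  rw [← HTensor.map_mul, parity_mul_parity, one_mul, HTensor.map_one]

open HTensor in
-- Here the reflection sits on the first leg and commutes with `R₂₃`. The inverse of `R` is what
-- produces the order of factors required on the right.
theorem yangBaxter_parityFst_conj
    (V : 𝓗 ≃ₗᵢ[ℂ] Lp (EuclideanSpace ℂ ι) 2 (volume : Measure ℝ))
    (h : leg12 𝓗 R * leg13 𝓗 R * leg23 𝓗 R = leg23 𝓗 R * leg13 𝓗 R * leg12 𝓗 R) :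
    leg23 𝓗 R * leg12 𝓗 (parityFst V * R⁻¹ * parityFst V)
        * leg13 𝓗 (parityFst V * R⁻¹ * parityFst V)
      = leg13 𝓗 (parityFst V * R⁻¹ * parityFst V) * leg12 𝓗 (parityFst V * R⁻¹ * parityFst V)
        * leg23 𝓗 R := by
  have hp : HTensor.map (parityFst V) (1 : 𝓗 ≃ₗᵢ[ℂ] 𝓗) * HTensor.map (parityFst V) 1 = 1 := by
    rw [← HTensor.map_mul, parityFst_mul_self, one_mul, HTensor.map_one]
  have h₁ : leg13 𝓗 (parityFst V) = HTensor.map (parityFst V) 1 := leg13_map_one _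
  have h₂ : leg12 𝓗 (parityFst V) = HTensor.map (parityFst V) 1 := rfl
  simp only [leg13_mul, leg12_mul, leg13_inv, leg12_inv, h₁, h₂]
  exact conj_yangBaxter_right hp (commute_leg23 R (parity V)) h

variable [CompleteSpace 𝓗] {H : StandardSubspace 𝓗} {T : ℝ → 𝓗 ≃ₗᵢ[ℂ] 𝓗} {J : 𝓗 ≃ₗᵢ⋆[ℂ] 𝓗}
  {Δ : ℝ → 𝓗 ≃ₗᵢ[ℂ] 𝓗} {bar : ι → ι}

theorem commute_paritySnd_conj (hV : IsParametrization bar T J Δ V)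
    (hR : IsScatteringOperator H T J Δ R) (t : ℝ) :
    Commute (paritySnd V * R * paritySnd V) (HTensor.map (Δ t) (Δ (-t))) := by
  have h₁ : parity V * Δ (-t) = Δ t * parity V :=
    mul_parity_of_translation V (s := 2 * Real.pi * t) (hV.dilation t) (fun f => by
      simpa using hV.dilation (-t) f)
  have h₂ : Δ (-t) * parity V = parity V * Δ t := by
    calc Δ (-t) * parity V = parity V * (parity V * Δ (-t)) * parity V := by
          rw [← mul_assoc, parity_mul_parity, one_mul]
      _ = _ := by rw [h₁, mul_assoc, mul_assoc, parity_mul_parity, mul_one]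
  have h₃ : paritySnd V * HTensor.map (Δ t) (Δ (-t))
      = HTensor.map (Δ t) (Δ t) * paritySnd V := by
    rw [← HTensor.map_mul, ← HTensor.map_mul, h₁, one_mul, mul_one]
  have h₄ : HTensor.map (Δ t) (Δ (-t)) * paritySnd V
      = paritySnd V * HTensor.map (Δ t) (Δ t) := by
    rw [← HTensor.map_mul, ← HTensor.map_mul, h₂, one_mul, mul_one]
  change paritySnd V * R * paritySnd V * _ = _ * (paritySnd V * R * paritySnd V)
  rw [mul_assoc, h₃, ← mul_assoc, mul_assoc (paritySnd V), (hR.dilation t).eq,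
    ← mul_assoc, ← mul_assoc, ← mul_assoc, h₄]

variable [DecidableEq ι] {S : HTensor 𝓗 𝓗 ≃ₗᵢ[ℂ] HTensor 𝓗 𝓗}
  {M : ℝ → Matrix (ι × ι) (ι × ι) ℂ}

open HTensor in
/-- Conjugation with the parity operator turns a scattering operator with flip symmetric matrix
function into a left-right scattering operator. -/
theorem IsScatteringOperator.isLeftRightScattering (hV : IsParametrization bar T J Δ V)
    (hR : IsScatteringOperator H T J Δ R)
    (hM : HasMatrixFunction V (fun q₁ q₂ => q₁ - q₂) R M) (hF : IsFlipSymmetric M)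
    (hS : HasMatrixFunction V (fun q₁ q₂ => q₁ + q₂) S M) :
    IsLeftRightScattering H T Δ R H T Δ R S := by
  have hP : paritySnd V * paritySnd V = 1 := paritySnd_mul_self
  have hSR : S = paritySnd V * R * paritySnd V := hS.eq hM.paritySnd_conj
  have hflip : comm 𝓗 𝓗 * S * comm 𝓗 𝓗 = S := hS.comm_conj hF
  -- The flip fixes `S`, moves the reflection to the first factor and replaces `R` by `R₂₁ = R⁻¹`.
  have hSR' : S = parityFst V * R⁻¹ * parityFst V := by
    have h₁ : comm 𝓗 𝓗 * paritySnd V = parityFst V * comm 𝓗 𝓗 := comm_mul_map _ _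
    have h₂ : paritySnd V * comm 𝓗 𝓗 = comm 𝓗 𝓗 * parityFst V := (comm_mul_map _ _).symm
    calc S = (comm 𝓗 𝓗 * paritySnd V) * R * (paritySnd V * comm 𝓗 𝓗) := by
          rw [← hflip, hSR]; group
      _ = parityFst V * (comm 𝓗 𝓗 * R * comm 𝓗 𝓗) * parityFst V := by rw [h₁, h₂]; group
      _ = _ := by rw [hR.reflection]
  have hSinv : S⁻¹ = paritySnd V * R⁻¹ * paritySnd V := by
    rw [hSR, mul_inv_rev, mul_inv_rev, eq_inv_of_mul_self hP, mul_assoc]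
  -- The reflection touches only `ξ` and `η`, so this is locality of `R` at the reflected vectors;
  -- no compatibility of `Π` with `H` is needed.
  have hleft : ∀ f ∈ H.toClosedSubmodule, ∀ g ∈ H.symplComp.toClosedSubmodule, ∀ ξ η : 𝓗,
      inner ℂ (HTensor.tmul g η) (S (HTensor.tmul f ξ))
        = inner ℂ (HTensor.tmul f η) (S⁻¹ (HTensor.tmul g ξ)) := by
    intro f hf g hg ξ η
    rw [hSinv, hSR]
    simp only [LinearIsometryEquiv.coe_mul, Function.comp_apply]
    rw [inner_involution_right hP, inner_involution_right hP]
    simp only [map_tmul]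
    exact hR.locality f hf g hg _ _
  refine ⟨fun t => ?_, fun t₁ t₂ => ?_, ?_, ?_, hleft, fun f hf g hg ξ η => ?_⟩
  · rw [hSR]
    exact commute_paritySnd_conj hV hR t
  · exact hS.commute_map (fun q => conj_exp_I_mul_exp_I _) (fun q => conj_exp_I_mul_exp_I _)
      (hV.translation t₁) (hV.translation t₂)
  · rw [hSR]
    exact yangBaxter_paritySnd_conj V hR.yangBaxter
  · rw [hSR']
    exact yangBaxter_parityFst_conj V hR.yangBaxter
  -- Flip invariance of `S` and `S⁻¹` reduces locality in the second factor to `hleft`.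
  · have hflip' : comm 𝓗 𝓗 * S⁻¹ * comm 𝓗 𝓗 = S⁻¹ := by
      rw [← inv_inj, mul_inv_rev, mul_inv_rev, eq_inv_of_mul_self comm_mul_comm, inv_inv,
        ← mul_assoc, hflip]
    conv_lhs => rw [← hflip]
    conv_rhs => rw [← hflip']
    simp only [LinearIsometryEquiv.coe_mul, Function.comp_apply]
    rw [inner_involution_right comm_mul_comm, inner_involution_right comm_mul_comm]
    simp only [comm_tmul]
    exact hleft f hf g hg ξ η

end LeftRight

/-! ### Uniqueness for the Fourier transform in the variables `e^{q₁}`, `e^{q₂}`. -/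

section Fourier

/-- The joint character `exp (i (t₁ e^{q₁} + t₂ e^{q₂}))` of the variables `e^{q₁}`, `e^{q₂}`. -/
def expChar (t₁ t₂ : ℝ) (q : ℝ × ℝ) : ℂ :=
  Complex.exp (I * (t₁ * Real.exp q.1 : ℝ)) * Complex.exp (I * (t₂ * Real.exp q.2 : ℝ))

theorem continuous_expChar (t₁ t₂ : ℝ) : Continuous (expChar t₁ t₂) := by
  unfold expChar; fun_prop

theorem conj_expChar (t₁ t₂ : ℝ) (q : ℝ × ℝ) : conj (expChar t₁ t₂ q) = expChar (-t₁) (-t₂) q := by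
  simp only [expChar, map_mul, ← Complex.exp_conj, conj_I, conj_ofReal]
  push_cast
  ring_nf

theorem norm_expChar (t₁ t₂ : ℝ) (q : ℝ × ℝ) : ‖expChar t₁ t₂ q‖ = 1 := by
  rw [expChar, norm_mul, norm_exp_I_mul_ofReal, norm_exp_I_mul_ofReal, mul_one]

theorem Continuous.integrable_mul_of_norm_eq_one {X : Type*} [TopologicalSpace X]
    [MeasurableSpace X] [OpensMeasurableSpace X] {μ : Measure X} {u G : X → ℂ}
    (hc : Continuous u) (hn : ∀ x, ‖u x‖ = 1) (hG : Integrable G μ) :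
    Integrable (fun x => u x * G x) μ :=
  hG.bdd_mul hc.aestronglyMeasurable (c := 1) (Filter.Eventually.of_forall fun x => (hn x).le)

theorem integrable_expChar_mul {G : ℝ × ℝ → ℂ} (hG : Integrable G) (t₁ t₂ : ℝ) :
    Integrable fun q => expChar t₁ t₂ q * G q :=
  (continuous_expChar t₁ t₂).integrable_mul_of_norm_eq_one (norm_expChar t₁ t₂) hG

/-- The map `(q₁, q₂) ↦ (e^{q₁}, e^{q₂})`. -/
def expPair (q : ℝ × ℝ) : ℝ × ℝ := (Real.exp q.1, Real.exp q.2)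

theorem measurable_expPair : Measurable expPair := by unfold expPair; fun_prop

theorem integral_expChar_withDensity {G : ℝ × ℝ → ℝ} (hG : Integrable G) (t₁ t₂ : ℝ) :
    ∫ q, expChar t₁ t₂ q ∂(volume.withDensity fun q => ENNReal.ofReal (G q))
      = ∫ q, expChar t₁ t₂ q * (max (G q) 0 : ℝ) := by
  rw [integral_withDensity_eq_integral_toReal_smul₀ hG.aestronglyMeasurable.aemeasurable.ennreal_ofReal
    (Filter.Eventually.of_forall fun _ => ENNReal.ofReal_lt_top)]
  refine integral_congr_ae (Filter.Eventually.of_forall fun q => ?_)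
  simp only [ENNReal.toReal_ofReal', real_smul, mul_comm]

/-- The positive and negative parts of `G` are densities of finite measures. Their images under
`expPair` have equal characteristic functions, hence coincide, and taking logarithms undoes
`expPair`. -/
theorem ae_eq_zero_of_integral_expChar_real {G : ℝ × ℝ → ℝ} (hG : Integrable G)
    (h : ∀ t₁ t₂, ∫ q, expChar t₁ t₂ q * (G q : ℂ) = 0) : G =ᵐ[volume] 0 := by
  have := isFiniteMeasure_withDensity_ofReal hG.2
  have := isFiniteMeasure_withDensity_ofReal hG.neg.2
  set μ := (volume : Measure (ℝ × ℝ)).withDensity fun q => ENNReal.ofReal (G q) with hμ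
  set ν := (volume : Measure (ℝ × ℝ)).withDensity fun q => ENNReal.ofReal ((-G) q) with hν
  have hint : ∀ {F : ℝ × ℝ → ℝ}, Integrable F → ∀ t₁ t₂,
      Integrable fun q => expChar t₁ t₂ q * (max (F q) 0 : ℝ) := fun hF t₁ t₂ =>
    integrable_expChar_mul hF.pos_part.ofReal t₁ t₂
  have hmap : μ.map expPair = ν.map expPair := by
    refine Measure.ext_of_charFunDual (funext fun L => ?_)
    have hL : ∀ q : ℝ × ℝ, Complex.exp (L (expPair q) * I) = expChar (L (1, 0)) (L (0, 1)) q := by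
      intro q
      have : expPair q = Real.exp q.1 • ((1, 0) : ℝ × ℝ) + Real.exp q.2 • ((0, 1) : ℝ × ℝ) := by
        simp [expPair]
      rw [this, map_add, map_smul, map_smul, expChar, ← Complex.exp_add]
      congr 1
      simp only [smul_eq_mul]
      push_cast
      ring
    have hc : Continuous fun v : ℝ × ℝ => Complex.exp (L v * I) := by fun_prop
    rw [charFunDual_apply, charFunDual_apply,
      integral_map measurable_expPair.aemeasurable hc.aestronglyMeasurable,
      integral_map measurable_expPair.aemeasurable hc.aestronglyMeasurable]
    simp only [hL]
    rw [hμ, hν, integral_expChar_withDensity hG, integral_expChar_withDensity hG.neg,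
      ← sub_eq_zero, ← integral_sub (hint hG _ _) (hint hG.neg _ _), ← h (L (1, 0)) (L (0, 1))]
    refine integral_congr_ae (Filter.Eventually.of_forall fun q => ?_)
    simp only [← mul_sub, ← ofReal_sub, Pi.neg_apply]
    rw [max_zero_sub_max_neg_zero_eq_self]
  have hlog : Measurable fun q : ℝ × ℝ => (Real.log q.1, Real.log q.2) := by fun_prop
  have hid : (fun q : ℝ × ℝ => (Real.log q.1, Real.log q.2)) ∘ expPair = id := by
    funext q; simp [expPair]
  have hμν : μ = ν := by
    have := congrArg (Measure.map fun q : ℝ × ℝ => (Real.log q.1, Real.log q.2)) hmap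
    rwa [Measure.map_map hlog measurable_expPair, Measure.map_map hlog measurable_expPair, hid,
      Measure.map_id, Measure.map_id] at this
  rw [hμ, hν, withDensity_eq_iff_of_sigmaFinite hG.aestronglyMeasurable.aemeasurable.ennreal_ofReal
    hG.neg.aestronglyMeasurable.aemeasurable.ennreal_ofReal] at hμν
  filter_upwards [hμν] with q hq
  have h₁ := congrArg ENNReal.toReal hq
  simp only [ENNReal.toReal_ofReal', Pi.neg_apply] at h₁
  rw [← max_zero_sub_max_neg_zero_eq_self (G q), h₁, sub_self, Pi.zero_apply]

/-- An integrable function on the plane vanishes if its Fourier transform with respect to the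
variables `e^{q₁}`, `e^{q₂}` does. -/
theorem ae_eq_zero_of_integral_expChar {G : ℝ × ℝ → ℂ} (hG : Integrable G)
    (h : ∀ t₁ t₂, ∫ q, expChar t₁ t₂ q * G q = 0) : G =ᵐ[volume] 0 := by
  have hGc : Integrable fun q => conj (G q) :=
    (LinearIsometryEquiv.integrable_comp_iff conjLIE).2 hG
  -- Conjugation negates `t₁`, `t₂`, so the transform of `conj G` vanishes as well, and with it
  -- those of the real and imaginary parts.
  have hconj : ∀ t₁ t₂, ∫ q, expChar t₁ t₂ q * conj (G q) = 0 := by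
    intro t₁ t₂
    rw [← map_zero (starRingEnd ℂ), ← h (-t₁) (-t₂), ← integral_conj]
    refine integral_congr_ae (Filter.Eventually.of_forall fun q => ?_)
    simp only [map_mul, conj_expChar, neg_neg]
  have hre : (fun q => (G q).re) =ᵐ[volume] 0 := by
    refine ae_eq_zero_of_integral_expChar_real hG.re fun t₁ t₂ => ?_
    have : ∀ q, expChar t₁ t₂ q * ((G q).re : ℂ)
        = (1 / 2 : ℂ) * (expChar t₁ t₂ q * G q + expChar t₁ t₂ q * conj (G q)) := fun q => by
      rw [re_eq_add_conj]; ring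
    simp only [this]
    rw [integral_const_mul, integral_add (integrable_expChar_mul hG _ _)
      (integrable_expChar_mul hGc _ _), h, hconj, add_zero, mul_zero]
  have him : (fun q => (G q).im) =ᵐ[volume] 0 := by
    refine ae_eq_zero_of_integral_expChar_real hG.im fun t₁ t₂ => ?_
    have : ∀ q, expChar t₁ t₂ q * ((G q).im : ℂ)
        = (1 / (2 * I) : ℂ) * (expChar t₁ t₂ q * G q - expChar t₁ t₂ q * conj (G q)) := fun q => by
      rw [im_eq_sub_conj]; ring
    simp only [this]
    rw [integral_const_mul, integral_sub (integrable_expChar_mul hG _ _)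
      (integrable_expChar_mul hGc _ _), h, hconj, sub_zero, mul_zero]
  filter_upwards [hre, him] with q h₁ h₂
  exact Complex.ext h₁ h₂

end Fourier

/-! ### Realizing the Hilbert tensor product in `L²` of the plane. -/

section TensorL2

variable {ι κ : Type*}

/-- The pointwise tensor product of two vector-valued functions. -/
def tensorFun (f : ℝ → EuclideanSpace ℂ ι) (g : ℝ → EuclideanSpace ℂ κ) (q : ℝ × ℝ) :
    EuclideanSpace ℂ (ι × κ) :=
  WithLp.toLp 2 fun i => f q.1 i.1 * g q.2 i.2

theorem tensorFun_apply (f : ℝ → EuclideanSpace ℂ ι) (g : ℝ → EuclideanSpace ℂ κ) (q : ℝ × ℝ)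
    (i : ι × κ) : tensorFun f g q i = f q.1 i.1 * g q.2 i.2 := rfl

variable [Fintype ι] [Fintype κ]

theorem inner_tensorFun (f f' : ℝ → EuclideanSpace ℂ ι) (g g' : ℝ → EuclideanSpace ℂ κ)
    (q : ℝ × ℝ) : inner ℂ (tensorFun f g q) (tensorFun f' g' q)
      = inner ℂ (f q.1) (f' q.1) * inner ℂ (g q.2) (g' q.2) := by
  simp only [PiLp.inner_apply, tensorFun_apply, RCLike.inner_apply, map_mul, Fintype.sum_prod_type,
    Finset.sum_mul_sum]
  refine Finset.sum_congr rfl fun i _ => Finset.sum_congr rfl fun j _ => ?_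
  ring

theorem norm_sq_tensorFun (f : ℝ → EuclideanSpace ℂ ι) (g : ℝ → EuclideanSpace ℂ κ) (q : ℝ × ℝ) :
    ‖tensorFun f g q‖ ^ 2 = ‖f q.1‖ ^ 2 * ‖g q.2‖ ^ 2 := by
  have := inner_tensorFun f f g g q
  simp only [inner_self_eq_norm_sq_to_K] at this
  exact_mod_cast this

theorem measurable_tensorFun {f : ℝ → EuclideanSpace ℂ ι} {g : ℝ → EuclideanSpace ℂ κ}
    (hf : Measurable f) (hg : Measurable g) : Measurable (tensorFun f g) := by
  refine (WithLp.measurable_toLp 2 _).comp (measurable_pi_iff.2 fun i => ?_)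
  have h₁ : Measurable fun q : ℝ × ℝ => f q.1 i.1 :=
    (EuclideanSpace.proj (𝕜 := ℂ) i.1).continuous.measurable.comp (hf.comp measurable_fst)
  have h₂ : Measurable fun q : ℝ × ℝ => g q.2 i.2 :=
    (EuclideanSpace.proj (𝕜 := ℂ) i.2).continuous.measurable.comp (hg.comp measurable_snd)
  exact h₁.mul h₂

theorem memLp_tensorFun (f : Lp (EuclideanSpace ℂ ι) 2 (volume : Measure ℝ))
    (g : Lp (EuclideanSpace ℂ κ) 2 (volume : Measure ℝ)) :
    MemLp (tensorFun f g) 2 (volume : Measure (ℝ × ℝ)) := by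
  have hm := measurable_tensorFun (Lp.stronglyMeasurable f).measurable
    (Lp.stronglyMeasurable g).measurable
  rw [memLp_two_iff_integrable_sq_norm hm.aestronglyMeasurable]
  simp only [norm_sq_tensorFun]
  exact ((memLp_two_iff_integrable_sq_norm (Lp.aestronglyMeasurable f)).1 (Lp.memLp f)).mul_prod
    ((memLp_two_iff_integrable_sq_norm (Lp.aestronglyMeasurable g)).1 (Lp.memLp g))

/-- The tensor product of two square integrable functions, as a square integrable function. -/
def tensorLp (f : Lp (EuclideanSpace ℂ ι) 2 (volume : Measure ℝ))
    (g : Lp (EuclideanSpace ℂ κ) 2 (volume : Measure ℝ)) :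
    Lp (EuclideanSpace ℂ (ι × κ)) 2 (volume : Measure (ℝ × ℝ)) :=
  (memLp_tensorFun f g).toLp _

theorem coeFn_tensorLp (f : Lp (EuclideanSpace ℂ ι) 2 (volume : Measure ℝ))
    (g : Lp (EuclideanSpace ℂ κ) 2 (volume : Measure ℝ)) :
    tensorLp f g =ᵐ[volume] tensorFun f g := MemLp.coeFn_toLp _

theorem inner_tensorLp (f f' : Lp (EuclideanSpace ℂ ι) 2 (volume : Measure ℝ))
    (g g' : Lp (EuclideanSpace ℂ κ) 2 (volume : Measure ℝ)) :
    inner ℂ (tensorLp f g) (tensorLp f' g') = inner ℂ f f' * inner ℂ g g' := by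
  rw [L2.inner_def, L2.inner_def, L2.inner_def, ← integral_prod_mul]
  refine integral_congr_ae ?_
  filter_upwards [coeFn_tensorLp f g, coeFn_tensorLp f' g'] with q h₁ h₂
  rw [h₁, h₂, inner_tensorFun]

variable (ι κ) in
/-- The tensor product of square integrable functions as a bilinear map. -/
def tensorLpₗ : Lp (EuclideanSpace ℂ ι) 2 (volume : Measure ℝ) →ₗ[ℂ]
    Lp (EuclideanSpace ℂ κ) 2 (volume : Measure ℝ) →ₗ[ℂ]
      Lp (EuclideanSpace ℂ (ι × κ)) 2 (volume : Measure (ℝ × ℝ)) :=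
  LinearMap.mk₂ ℂ tensorLp
    (fun f f' g => by
      apply Lp.ext
      filter_upwards [coeFn_tensorLp (f + f') g, Lp.coeFn_add (tensorLp f g) (tensorLp f' g),
        coeFn_tensorLp f g, coeFn_tensorLp f' g, ae_fst (Lp.coeFn_add f f')] with q a b c d e
      rw [a, b, Pi.add_apply, c, d]
      ext i
      simp only [tensorFun_apply, e, Pi.add_apply, PiLp.add_apply, add_mul])
    (fun c f g => by
      apply Lp.ext
      filter_upwards [coeFn_tensorLp (c • f) g, Lp.coeFn_smul c (tensorLp f g),
        coeFn_tensorLp f g, ae_fst (Lp.coeFn_smul c f)] with q a b d e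
      rw [a, b, Pi.smul_apply, d]
      ext i
      simp only [tensorFun_apply, e, Pi.smul_apply, PiLp.smul_apply, smul_eq_mul, mul_assoc])
    (fun f g g' => by
      apply Lp.ext
      filter_upwards [coeFn_tensorLp f (g + g'), Lp.coeFn_add (tensorLp f g) (tensorLp f g'),
        coeFn_tensorLp f g, coeFn_tensorLp f g', ae_snd (Lp.coeFn_add g g')] with q a b c d e
      rw [a, b, Pi.add_apply, c, d]
      ext i
      simp only [tensorFun_apply, e, Pi.add_apply, PiLp.add_apply, mul_add])
    (fun c f g => by
      apply Lp.ext
      filter_upwards [coeFn_tensorLp f (c • g), Lp.coeFn_smul c (tensorLp f g),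
        coeFn_tensorLp f g, ae_snd (Lp.coeFn_smul c g)] with q a b d e
      rw [a, b, Pi.smul_apply, d]
      ext i
      simp only [tensorFun_apply, e, Pi.smul_apply, PiLp.smul_apply, smul_eq_mul, mul_left_comm])

variable {𝓗 𝓚 : Type*} [NormedAddCommGroup 𝓗] [InnerProductSpace ℂ 𝓗]
  [NormedAddCommGroup 𝓚] [InnerProductSpace ℂ 𝓚]

/-- The isometry from the algebraic tensor product into `L²(ℝ², ℂ^(ι × κ))` induced by isometries
into `L²(ℝ, ℂ^ι)` and `L²(ℝ, ℂ^κ)`. -/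
def tensorRepAlg (V : 𝓗 →ₗᵢ[ℂ] Lp (EuclideanSpace ℂ ι) 2 (volume : Measure ℝ))
    (W : 𝓚 →ₗᵢ[ℂ] Lp (EuclideanSpace ℂ κ) 2 (volume : Measure ℝ)) :
    𝓗 ⊗[ℂ] 𝓚 →ₗᵢ[ℂ] Lp (EuclideanSpace ℂ (ι × κ)) 2 (volume : Measure (ℝ × ℝ)) :=
  (TensorProduct.lift ((tensorLpₗ ι κ).compl₁₂ V.toLinearMap W.toLinearMap)).isometryOfInner (by
    intro x y
    induction x using TensorProduct.induction_on with
    | zero => simp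
    | add x₁ x₂ h₁ h₂ => rw [map_add, inner_add_left, inner_add_left, h₁, h₂]
    | tmul a b =>
      induction y using TensorProduct.induction_on with
      | zero => simp
      | add y₁ y₂ h₁ h₂ => rw [map_add, inner_add_right, inner_add_right, h₁, h₂]
      | tmul c d =>
        change inner ℂ (tensorLp (V a) (W b)) (tensorLp (V c) (W d)) = _
        rw [inner_tensorLp, V.inner_map_map, W.inner_map_map, TensorProduct.inner_tmul])

/-- The isometry from the Hilbert tensor product into `L²(ℝ², ℂ^(ι × κ))` induced by isometries
into `L²(ℝ, ℂ^ι)` and `L²(ℝ, ℂ^κ)`. -/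
def tensorRep (V : 𝓗 →ₗᵢ[ℂ] Lp (EuclideanSpace ℂ ι) 2 (volume : Measure ℝ))
    (W : 𝓚 →ₗᵢ[ℂ] Lp (EuclideanSpace ℂ κ) 2 (volume : Measure ℝ)) :
    HTensor 𝓗 𝓚 →ₗᵢ[ℂ] Lp (EuclideanSpace ℂ (ι × κ)) 2 (volume : Measure (ℝ × ℝ)) :=
  { ((tensorRepAlg V W).toContinuousLinearMap.extend
      (HTensor.incl 𝓗 𝓚).toContinuousLinearMap).toLinearMap with
    norm_map' := by
      have he : ∀ x, (tensorRepAlg V W).toContinuousLinearMap.extend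
          (HTensor.incl 𝓗 𝓚).toContinuousLinearMap (HTensor.incl 𝓗 𝓚 x) = tensorRepAlg V W x :=
        ContinuousLinearMap.extend_eq _ (HTensor.denseRange_incl 𝓗 𝓚)
          (HTensor.incl 𝓗 𝓚).isometry.isUniformInducing
      refine isClosed_property (HTensor.denseRange_incl 𝓗 𝓚)
        (isClosed_eq (ContinuousLinearMap.continuous _).norm continuous_norm) fun x => ?_
      change ‖(tensorRepAlg V W).toContinuousLinearMap.extend
          (HTensor.incl 𝓗 𝓚).toContinuousLinearMap (HTensor.incl 𝓗 𝓚 x)‖ = ‖HTensor.incl 𝓗 𝓚 x‖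
      rw [he, LinearIsometry.norm_map, LinearIsometry.norm_map] }

theorem tensorRep_tmul (V : 𝓗 →ₗᵢ[ℂ] Lp (EuclideanSpace ℂ ι) 2 (volume : Measure ℝ))
    (W : 𝓚 →ₗᵢ[ℂ] Lp (EuclideanSpace ℂ κ) 2 (volume : Measure ℝ)) (f : 𝓗) (g : 𝓚) :
    tensorRep V W (HTensor.tmul f g) = tensorLp (V f) (W g) :=
  ContinuousLinearMap.extend_eq _ (HTensor.denseRange_incl 𝓗 𝓚)
    (HTensor.incl 𝓗 𝓚).isometry.isUniformInducing (f ⊗ₜ g)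

theorem coeFn_tensorRep_tmul (V : 𝓗 →ₗᵢ[ℂ] Lp (EuclideanSpace ℂ ι) 2 (volume : Measure ℝ))
    (W : 𝓚 →ₗᵢ[ℂ] Lp (EuclideanSpace ℂ κ) 2 (volume : Measure ℝ)) (f : 𝓗) (g : 𝓚) :
    tensorRep V W (HTensor.tmul f g) =ᵐ[volume] tensorFun (V f) (W g) := by
  rw [tensorRep_tmul]; exact coeFn_tensorLp _ _

end TensorL2

/-! ### Fibrewise decomposition of operators commuting with the characters. -/

section Decomposition

theorem memLp_expChar_smul {K : Type*} [NormedAddCommGroup K] [NormedSpace ℂ K] (t₁ t₂ : ℝ)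
    (f : Lp K 2 (volume : Measure (ℝ × ℝ))) :
    MemLp (fun q => expChar t₁ t₂ q • f q) 2 (volume : Measure (ℝ × ℝ)) :=
  (Lp.memLp f).of_le
    ((continuous_expChar t₁ t₂).aestronglyMeasurable.smul (Lp.aestronglyMeasurable f))
    (Filter.Eventually.of_forall fun q => by rw [norm_smul, norm_expChar, one_mul])

/-- Multiplication by the character `expChar t₁ t₂` on a space of square integrable functions. -/
def expCharMul (K : Type*) [NormedAddCommGroup K] [NormedSpace ℂ K] (t₁ t₂ : ℝ) :
    Lp K 2 (volume : Measure (ℝ × ℝ)) →ₗᵢ[ℂ] Lp K 2 (volume : Measure (ℝ × ℝ)) :=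
  have hm := memLp_expChar_smul (K := K) t₁ t₂
  { toFun := fun f => (hm f).toLp _
    map_add' := fun f g => by
      apply Lp.ext
      filter_upwards [(hm (f + g)).coeFn_toLp, (hm f).coeFn_toLp, (hm g).coeFn_toLp,
        Lp.coeFn_add ((hm f).toLp _) ((hm g).toLp _), Lp.coeFn_add f g] with q a b c d e
      rw [a, d, Pi.add_apply, b, c, e, Pi.add_apply, smul_add]
    map_smul' := fun k f => by
      apply Lp.ext
      filter_upwards [(hm (k • f)).coeFn_toLp, (hm f).coeFn_toLp,
        Lp.coeFn_smul k ((hm f).toLp _), Lp.coeFn_smul k f] with q a b d e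
      rw [RingHom.id_apply, a, d, Pi.smul_apply, b, e, Pi.smul_apply, smul_comm]
    norm_map' := fun f => by
      have h : ∀ᵐ q, ‖(hm f).toLp _ q‖ = ‖f q‖ := by
        filter_upwards [(hm f).coeFn_toLp] with q a
        rw [a, norm_smul, norm_expChar, one_mul]
      exact le_antisymm (Lp.norm_le_norm_of_ae_le (h.mono fun q hq => hq.le))
        (Lp.norm_le_norm_of_ae_le (h.mono fun q hq => hq.ge)) }

theorem coeFn_expCharMul {K : Type*} [NormedAddCommGroup K] [NormedSpace ℂ K] (t₁ t₂ : ℝ)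
    (f : Lp K 2 (volume : Measure (ℝ × ℝ))) :
    ∀ᵐ q, expCharMul K t₁ t₂ f q = expChar t₁ t₂ q • f q :=
  (memLp_expChar_smul t₁ t₂ f).coeFn_toLp

variable {X K : Type*} [NormedAddCommGroup X] [InnerProductSpace ℂ X]
  [NormedAddCommGroup K] [InnerProductSpace ℂ K]

/-- An isometry commuting with all characters is fibrewise: its matrix elements agree with those
of its inverse almost everywhere, and not only after integration. -/
theorem ae_inner_eq_of_commute {W : X →ₗᵢ[ℂ] Lp K 2 (volume : Measure (ℝ × ℝ))}
    {R : X ≃ₗᵢ[ℂ] X} {U : ℝ → ℝ → X ≃ₗᵢ[ℂ] X}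
    (hW : ∀ t₁ t₂ x, W (U t₁ t₂ x) = expCharMul K t₁ t₂ (W x))
    (hR : ∀ t₁ t₂, Commute R (U t₁ t₂)) (x y : X) :
    ∀ᵐ q, inner ℂ (W x q) (W (R y) q) = inner ℂ (W (R⁻¹ x) q) (W y q) := by
  have h₁ := L2.integrable_inner (𝕜 := ℂ) (W x) (W (R y))
  have h₂ := L2.integrable_inner (𝕜 := ℂ) (W (R⁻¹ x)) (W y)
  have key : ∀ (t₁ t₂ : ℝ) (a b : X), ∫ q, expChar t₁ t₂ q * inner ℂ (W a q) (W b q)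
      = inner ℂ a (U t₁ t₂ b) := by
    intro t₁ t₂ a b
    rw [← W.inner_map_map, hW, L2.inner_def]
    refine integral_congr_ae ?_
    filter_upwards [coeFn_expCharMul t₁ t₂ (W b)] with q hq
    rw [hq, inner_smul_right]
  -- The two transforms are `⟨x, U R y⟩` and `⟨R⁻¹ x, U y⟩ = ⟨x, R U y⟩`, equal because `R` commutes
  -- with `U`.
  have := ae_eq_zero_of_integral_expChar (h₁.sub h₂) fun t₁ t₂ => by
    simp only [Pi.sub_apply, mul_sub]
    rw [integral_sub (integrable_expChar_mul h₁ t₁ t₂) (integrable_expChar_mul h₂ t₁ t₂),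
      key, key, sub_eq_zero, ← R.inner_map_map (R⁻¹ x)]
    change _ = inner ℂ ((R * R⁻¹) x) ((R * U t₁ t₂) y)
    rw [mul_inv_cancel, (hR t₁ t₂).eq]
    rfl
  filter_upwards [this] with q hq
  exact sub_eq_zero.1 hq

variable {κ : Type*} [Fintype κ] [DecidableEq κ]

/-- An operator commuting with all characters is multiplication by a matrix-valued function. -/
theorem exists_matrixFunction {W : X →ₗᵢ[ℂ] Lp (EuclideanSpace ℂ κ) 2 (volume : Measure (ℝ × ℝ))}
    {R : X ≃ₗᵢ[ℂ] X} {Φ : κ → X} {w : ℝ × ℝ → ℝ} (hw : Measurable w) (hw₀ : ∀ q, w q ≠ 0)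
    (hΦ : ∀ i, ∀ᵐ q, W (Φ i) q = EuclideanSpace.single i (w q : ℂ))
    (hR : ∀ x y, ∀ᵐ q, inner ℂ (W x q) (W (R y) q) = inner ℂ (W (R⁻¹ x) q) (W y q)) :
    ∃ N : ℝ × ℝ → Matrix κ κ ℂ, (∀ i j, Measurable fun q => N q i j) ∧
      (∀ x, ∀ᵐ q, ∀ i, W (R x) q i = ∑ j, N q i j * W x q j) ∧
      ∀ᵐ q, N q ∈ Matrix.unitaryGroup κ ℂ := by
  have hwc : ∀ q, (w q : ℂ) ≠ 0 := fun q => ofReal_ne_zero.2 (hw₀ q)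
  -- Pairing `R x` with `Φ i`, which is `w` times the `i`-th basis vector, reads off its `i`-th
  -- component; moving `R` across identifies row `i` of the matrix.
  let N : ℝ × ℝ → Matrix κ κ ℂ := fun q => Matrix.of fun i j => conj (W (R⁻¹ (Φ i)) q j) / w q
  have hN : ∀ x, ∀ᵐ q, ∀ i, W (R x) q i = ∑ j, N q i j * W x q j := by
    intro x
    rw [ae_all_iff]
    intro i
    filter_upwards [hR (Φ i) x, hΦ i] with q h₁ h₂
    rw [h₂, EuclideanSpace.inner_single_left, conj_ofReal, PiLp.inner_apply] at h₁
    rw [← mul_right_inj' (hwc q), h₁, Finset.mul_sum]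
    refine Finset.sum_congr rfl fun j _ => ?_
    simp only [RCLike.inner_apply, N, Matrix.of_apply]
    field_simp [hwc q]
  refine ⟨N, fun i j => ?_, hN, ?_⟩
  · have h₁ : Measurable fun q => W (R⁻¹ (Φ i)) q j :=
      (EuclideanSpace.proj (𝕜 := ℂ) j).continuous.measurable.comp
        (Lp.stronglyMeasurable (W (R⁻¹ (Φ i)))).measurable
    exact (continuous_conj.measurable.comp h₁).div (measurable_ofReal.comp hw)
  -- The fibrewise identity at `R (Φ i)` and `Φ j` says that `R` preserves inner products pointwise.
  -- As `R (Φ k)` is `w` times the `k`-th column of `N`, the columns are orthonormal.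
  · have h₁ : ∀ᵐ q, ∀ i j, inner ℂ (W (R (Φ i)) q) (W (R (Φ j)) q)
        = inner ℂ (W (Φ i) q) (W (Φ j) q) := by
      simp only [ae_all_iff]
      intro i j
      filter_upwards [hR (R (Φ i)) (Φ j)] with q hq
      rw [hq]
      change inner ℂ (W ((R⁻¹ * R) (Φ i)) q) _ = _
      rw [inv_mul_cancel]
      rfl
    have h₂ : ∀ᵐ q, ∀ k i, W (R (Φ k)) q i = N q i k * w q := by
      rw [ae_all_iff]
      intro k
      filter_upwards [hN (Φ k), hΦ k] with q a b i
      rw [a i, b]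
      simp
    filter_upwards [h₁, h₂, ae_all_iff.2 hΦ] with q a b c
    rw [Matrix.mem_unitaryGroup_iff']
    ext i j
    have h := a i j
    simp only [PiLp.inner_apply, b, c, RCLike.inner_apply, map_mul, conj_ofReal] at h
    rw [Matrix.mul_apply, Matrix.one_apply]
    have hww : (w q : ℂ) * w q ≠ 0 := mul_ne_zero (hwc q) (hwc q)
    rw [← mul_left_inj' hww, Finset.sum_mul]
    refine Eq.trans (Finset.sum_congr rfl fun k _ => ?_) (h.trans ?_)
    · rw [Matrix.star_apply, RCLike.star_def]
      ring
    · by_cases hij : i = j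
      · subst hij; simp
      · simp [hij, Ne.symm hij]

/-- Evaluating `R U (Φ j) = U R (Φ j)` gives column `j` of `N q` on one side and of `N (τ q)` on the
other, both times the nonzero factor `w (τ q)`. -/
theorem ae_translation_invariant
    {W : X →ₗᵢ[ℂ] Lp (EuclideanSpace ℂ κ) 2 (volume : Measure (ℝ × ℝ))}
    {R U : X ≃ₗᵢ[ℂ] X} {Φ : κ → X} {w : ℝ × ℝ → ℝ} (hw₀ : ∀ q, w q ≠ 0)
    (hΦ : ∀ i, ∀ᵐ q, W (Φ i) q = EuclideanSpace.single i (w q : ℂ))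
    {N : ℝ × ℝ → Matrix κ κ ℂ} (hN : ∀ x, ∀ᵐ q, ∀ i, W (R x) q i = ∑ j, N q i j * W x q j)
    {τ : ℝ × ℝ → ℝ × ℝ} (hτ : MeasurePreserving τ)
    (hU : ∀ x, ∀ᵐ q, W (U x) q = W x (τ q)) (hR : Commute R U) :
    ∀ᵐ q, N (τ q) = N q := by
  have h' : ∀ᵐ q, ∀ j i, N (τ q) i j = N q i j := by
    rw [ae_all_iff]
    intro j
    have hRU : R (U (Φ j)) = U (R (Φ j)) := congrArg (fun L : X ≃ₗᵢ[ℂ] X => L (Φ j)) hR.eq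
    filter_upwards [hN (U (Φ j)), hU (Φ j), hU (R (Φ j)),
      hτ.quasiMeasurePreserving.ae (hN (Φ j)), hτ.quasiMeasurePreserving.ae (hΦ j)]
      with q a b c d e i
    have h₁ := a i
    rw [hRU, c, d i, b, e] at h₁
    simpa [hw₀] using h₁
  filter_upwards [h'] with q hq
  ext i j
  exact hq j i

end Decomposition

/-! ### Functions on the plane invariant under diagonal translations. -/

section Invariance

/-- A function on the plane that is invariant under diagonal translations is a function of the
difference of the variables. -/
theorem exists_ae_eq_sub {Y : Type*} [TopologicalSpace Y] [MeasurableSpace Y] [BorelSpace Y]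
    [SecondCountableTopology Y] [T2Space Y] {N : ℝ × ℝ → Y} (hN : Measurable N)
    (h : ∀ s : ℝ, ∀ᵐ q : ℝ × ℝ, N (q.1 - s, q.2 - s) = N q) :
    ∃ M : ℝ → Y, Measurable M ∧ ∀ᵐ q : ℝ × ℝ, N q = M (q.1 - q.2) := by
  -- The exceptional null set depends on `s`; Fubini exchanges the quantifiers, so that `s` may then
  -- depend on `q`.
  have h₁ : ∀ᵐ q : ℝ × ℝ, ∀ᵐ s : ℝ, N (q.1 - s, q.2 - s) = N q := by
    refine (Measure.ae_ae_comm (p := fun (s : ℝ) (q : ℝ × ℝ) => N (q.1 - s, q.2 - s) = N q) ?_).1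
      (Filter.Eventually.of_forall h)
    exact measurableSet_eq_fun (by fun_prop) (by fun_prop)
  -- The shift `s = q₂ - y` moves `q` along the diagonal to the horizontal line of height `y`. A
  -- second exchange fixes one good `y`, and `M` is `N` on that line.
  have h₂ : ∀ᵐ q : ℝ × ℝ, ∀ᵐ y : ℝ, N (q.1 - (q.2 - y), q.2 - (q.2 - y)) = N q := by
    filter_upwards [h₁] with q hq
    exact (Measure.measurePreserving_sub_left (volume : Measure ℝ) q.2).quasiMeasurePreserving.ae hq
  have h₃ : ∀ᵐ y : ℝ, ∀ᵐ q : ℝ × ℝ, N (q.1 - (q.2 - y), q.2 - (q.2 - y)) = N q := by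
    refine (Measure.ae_ae_comm
      (p := fun (q : ℝ × ℝ) (y : ℝ) => N (q.1 - (q.2 - y), q.2 - (q.2 - y)) = N q) ?_).1 h₂
    exact measurableSet_eq_fun (by fun_prop) (by fun_prop)
  obtain ⟨y, hy⟩ := h₃.exists
  refine ⟨fun d => N (d + y, y), by fun_prop, ?_⟩
  filter_upwards [hy] with q hq
  rw [← hq]
  congr 2 <;> ring

/-- Restrict to a generic vertical line `q₁ = a` and substitute `d = a - q₂`. -/
theorem ae_of_ae_sub {p : ℝ → Prop} (h : ∀ᵐ q : ℝ × ℝ, p (q.1 - q.2)) : ∀ᵐ d : ℝ, p d := by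
  obtain ⟨a, ha⟩ := (Measure.ae_ae_of_ae_prod h).exists
  filter_upwards [(Measure.measurePreserving_sub_left (volume : Measure ℝ) a).quasiMeasurePreserving.ae ha]
    with d hd
  rwa [sub_sub_cancel] at hd

end Invariance

/-! ### Existence of the matrix function of a scattering operator. -/

section Existence

variable {𝓗 : Type*} [NormedAddCommGroup 𝓗] [InnerProductSpace ℂ 𝓗]
  {ι : Type*} [Fintype ι]
  (V : 𝓗 ≃ₗᵢ[ℂ] Lp (EuclideanSpace ℂ ι) 2 (volume : Measure ℝ))

theorem tensorRep_map_translation {A B : 𝓗 ≃ₗᵢ[ℂ] 𝓗} {t₁ t₂ : ℝ}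
    (hA : ∀ f, ∀ᵐ q : ℝ, V (A f) q = Complex.exp (I * (t₁ * Real.exp q : ℝ)) • V f q)
    (hB : ∀ f, ∀ᵐ q : ℝ, V (B f) q = Complex.exp (I * (t₂ * Real.exp q : ℝ)) • V f q)
    (x : HTensor 𝓗 𝓗) :
    tensorRep V.toLinearIsometry V.toLinearIsometry (HTensor.map A B x)
      = expCharMul _ t₁ t₂ (tensorRep V.toLinearIsometry V.toLinearIsometry x) := by
  set W := tensorRep V.toLinearIsometry V.toLinearIsometry with hW
  have := HTensor.ext_clm
    (A := (W.comp (HTensor.map A B).toLinearIsometry).toContinuousLinearMap)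
    (B := ((expCharMul _ t₁ t₂).comp W).toContinuousLinearMap) (fun f g => by
      change W (HTensor.map A B (HTensor.tmul f g)) = expCharMul _ t₁ t₂ (W (HTensor.tmul f g))
      rw [HTensor.map_tmul]
      apply Lp.ext
      filter_upwards [coeFn_tensorRep_tmul V.toLinearIsometry V.toLinearIsometry f g,
        coeFn_tensorRep_tmul V.toLinearIsometry V.toLinearIsometry (A f) (B g),
        coeFn_expCharMul t₁ t₂ (W (HTensor.tmul f g)), ae_fst (hA f), ae_snd (hB g)]
        with q a b c d e
      rw [b, c, a]
      ext i
      simp only [PiLp.smul_apply, tensorFun_apply, LinearIsometryEquiv.coe_toLinearIsometry, d, e,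
        smul_eq_mul, expChar]
      ring)
  exact congrArg (fun L => L x) this

theorem measurePreserving_sub_diag (s : ℝ) :
    MeasurePreserving (fun q : ℝ × ℝ => (q.1 - s, q.2 - s)) :=
  (measurePreserving_sub_right (volume : Measure ℝ) s).prod
    (measurePreserving_sub_right (volume : Measure ℝ) s)

theorem tensorRep_map_dilation {A : 𝓗 ≃ₗᵢ[ℂ] 𝓗} {s : ℝ}
    (hA : ∀ f, ∀ᵐ q : ℝ, V (A f) q = V f (q - s)) (x : HTensor 𝓗 𝓗) :
    ∀ᵐ q : ℝ × ℝ, tensorRep V.toLinearIsometry V.toLinearIsometry (HTensor.map A A x) q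
      = tensorRep V.toLinearIsometry V.toLinearIsometry x (q.1 - s, q.2 - s) := by
  set W := tensorRep V.toLinearIsometry V.toLinearIsometry with hW
  have hp := measurePreserving_sub_diag s
  have := HTensor.ext_clm
    (A := (W.comp (HTensor.map A A).toLinearIsometry).toContinuousLinearMap)
    (B := ((Lp.compMeasurePreservingₗᵢ ℂ _ hp).comp W).toContinuousLinearMap) (fun f g => by
      change W (HTensor.map A A (HTensor.tmul f g))
        = Lp.compMeasurePreserving _ hp (W (HTensor.tmul f g))
      rw [HTensor.map_tmul]
      apply Lp.ext
      filter_upwards [hp.quasiMeasurePreserving.ae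
          (coeFn_tensorRep_tmul V.toLinearIsometry V.toLinearIsometry f g),
        coeFn_tensorRep_tmul V.toLinearIsometry V.toLinearIsometry (A f) (A g),
        Lp.coeFn_compMeasurePreserving (W (HTensor.tmul f g)) hp, ae_fst (hA f), ae_snd (hA g)]
        with q a b c d e
      rw [b, c, Function.comp_apply, a]
      ext i
      simp only [tensorFun_apply, LinearIsometryEquiv.coe_toLinearIsometry, d, e])
  have hx : W (HTensor.map A A x) = Lp.compMeasurePreserving _ hp (W x) :=
    congrArg (fun L => L x) this
  rw [hx]
  exact Lp.coeFn_compMeasurePreserving (W x) hp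

variable [DecidableEq ι]

/-- The Gaussian serves as a square integrable function without zeros, so that one may divide by it
pointwise. -/
theorem memLp_single_gaussian (α : ι) :
    MemLp (fun q : ℝ => EuclideanSpace.single α (Real.exp (-1 * q ^ 2) : ℂ)) 2 volume := by
  have hc : Continuous fun q : ℝ => EuclideanSpace.single α (Real.exp (-1 * q ^ 2) : ℂ) :=
    (PiLp.continuous_toLp 2 _).comp
      ((continuous_single α).comp (by fun_prop))
  rw [memLp_two_iff_integrable_sq_norm hc.aestronglyMeasurable]
  refine (integrable_exp_neg_mul_sq (b := 2) (by norm_num)).congr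
    (Filter.Eventually.of_forall fun q => ?_)
  simp only [PiLp.norm_single, norm_real, Real.norm_eq_abs, sq_abs, ← Real.exp_nat_mul]
  ring_nf

variable [CompleteSpace 𝓗] {V} {H : StandardSubspace 𝓗} {T : ℝ → 𝓗 ≃ₗᵢ[ℂ] 𝓗}
  {J : 𝓗 ≃ₗᵢ⋆[ℂ] 𝓗} {Δ : ℝ → 𝓗 ≃ₗᵢ[ℂ] 𝓗} {bar : ι → ι} {R : HTensor 𝓗 𝓗 ≃ₗᵢ[ℂ] HTensor 𝓗 𝓗}

/-- A scattering operator is a matrix-valued function of the rapidity difference. -/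
theorem IsScatteringOperator.exists_hasMatrixFunction (hV : IsParametrization bar T J Δ V)
    (hR : IsScatteringOperator H T J Δ R) :
    ∃ M : ℝ → Matrix (ι × ι) (ι × ι) ℂ, HasMatrixFunction V (fun q₁ q₂ => q₁ - q₂) R M := by
  set W := tensorRep V.toLinearIsometry V.toLinearIsometry with hW
  let φ : ι → 𝓗 := fun α => V.symm ((memLp_single_gaussian α).toLp _)
  let Φ : ι × ι → HTensor 𝓗 𝓗 := fun i => HTensor.tmul (φ i.1) (φ i.2)
  let w : ℝ × ℝ → ℝ := fun q => Real.exp (-1 * q.1 ^ 2) * Real.exp (-1 * q.2 ^ 2)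
  have hw₀ : ∀ q, w q ≠ 0 := fun q => (mul_pos (Real.exp_pos _) (Real.exp_pos _)).ne'
  have hφ : ∀ α, ∀ᵐ q : ℝ, V (φ α) q = EuclideanSpace.single α (Real.exp (-1 * q ^ 2) : ℂ) := by
    intro α
    simp only [φ, LinearIsometryEquiv.apply_symm_apply]
    exact MemLp.coeFn_toLp _
  have hΦ : ∀ i, ∀ᵐ q, W (Φ i) q = EuclideanSpace.single i (w q : ℂ) := by
    intro i
    filter_upwards [coeFn_tensorRep_tmul V.toLinearIsometry V.toLinearIsometry (φ i.1) (φ i.2),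
      ae_fst (hφ i.1), ae_snd (hφ i.2)] with q a b c
    rw [hW, a]
    ext j
    simp only [tensorFun_apply, LinearIsometryEquiv.coe_toLinearIsometry, b, c, w,
      PiLp.single_apply, Prod.ext_iff, ofReal_mul]
    split_ifs <;> simp_all
  obtain ⟨N, hNm, hN, hNu⟩ := exists_matrixFunction (W := W) (R := R) (Φ := Φ) (w := w)
    (by fun_prop) hw₀ hΦ
    (ae_inner_eq_of_commute (U := fun t₁ t₂ => HTensor.map (T t₁) (T t₂))
      (fun t₁ t₂ => tensorRep_map_translation V (hV.translation t₁) (hV.translation t₂))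
      hR.translation)
  have hinv : ∀ s : ℝ, ∀ᵐ q : ℝ × ℝ, N (q.1 - s, q.2 - s) = N q := by
    intro s
    -- `Δ t` translates by `2πt`, so every shift `s` is attained at `t = s / (2π)`.
    have hs : 2 * Real.pi * (s / (2 * Real.pi)) = s := by field_simp
    exact ae_translation_invariant hw₀ hΦ hN (measurePreserving_sub_diag s)
      (tensorRep_map_dilation V (fun f => by
        simpa only [hs] using hV.dilation (s / (2 * Real.pi)) f))
      (hR.dilation (s / (2 * Real.pi)))
  -- Matrices are viewed as functions of two indices, so that measurability is entrywise.
  obtain ⟨M, hMm, hM⟩ := exists_ae_eq_sub (Y := ι × ι → ι × ι → ℂ)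
    (measurable_pi_iff.2 fun i => measurable_pi_iff.2 fun j => hNm i j) hinv
  refine ⟨M, fun i j => (measurable_pi_iff.1 (measurable_pi_iff.1 hMm i) j), ?_, fun f g h k => ?_⟩
  · refine ae_of_ae_sub (p := fun d => M d ∈ Matrix.unitaryGroup (ι × ι) ℂ) ?_
    filter_upwards [hM, hNu] with q a b
    rw [← a]
    exact b
  · rw [← W.inner_map_map, L2.inner_def]
    refine integral_congr_ae ?_
    filter_upwards [coeFn_tensorRep_tmul V.toLinearIsometry V.toLinearIsometry f g,
      coeFn_tensorRep_tmul V.toLinearIsometry V.toLinearIsometry h k, hN (HTensor.tmul f g), hM]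
      with q a b c d
    rw [PiLp.inner_apply, Fintype.sum_prod_type]
    refine Finset.sum_congr rfl fun α _ => Finset.sum_congr rfl fun β _ => ?_
    rw [c, hW, a, b, d, Fintype.sum_prod_type, RCLike.inner_apply, mul_comm, Finset.mul_sum]
    refine Finset.sum_congr rfl fun γ _ => ?_
    rw [Finset.mul_sum]
    rfl

end Existence

end

theorem mainTheorem5 {𝓗 : Type*} [NormedAddCommGroup 𝓗] [InnerProductSpace ℂ 𝓗] [CompleteSpace 𝓗]
    (H : StandardSubspace 𝓗) (T : ℝ → 𝓗 ≃ₗᵢ[ℂ] 𝓗) (hHT : IsStandardPair H T)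
    (J : 𝓗 ≃ₗᵢ⋆[ℂ] 𝓗) (Δ : ℝ → 𝓗 ≃ₗᵢ[ℂ] 𝓗) (hmod : IsModularPair H J Δ)
    {ι : Type*} [Fintype ι] [DecidableEq ι] (bar : ι → ι)
    (V : 𝓗 ≃ₗᵢ[ℂ] Lp (EuclideanSpace ℂ ι) 2 (volume : Measure ℝ))
    (hV : IsParametrization bar T J Δ V)
    (R : HTensor 𝓗 𝓗 ≃ₗᵢ[ℂ] HTensor 𝓗 𝓗) (hR : IsScatteringOperator H T J Δ R) :
    (∃ M : ℝ → Matrix (ι × ι) (ι × ι) ℂ,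
      HasMatrixFunction V (fun q₁ q₂ => q₁ - q₂) R M) ∧
    ∀ M : ℝ → Matrix (ι × ι) (ι × ι) ℂ,
      HasMatrixFunction V (fun q₁ q₂ => q₁ - q₂) R M → IsFlipSymmetric M →
      (∃ S : HTensor 𝓗 𝓗 ≃ₗᵢ[ℂ] HTensor 𝓗 𝓗,
        HasMatrixFunction V (fun q₁ q₂ => q₁ + q₂) S M) ∧
      ∀ S : HTensor 𝓗 𝓗 ≃ₗᵢ[ℂ] HTensor 𝓗 𝓗,
        HasMatrixFunction V (fun q₁ q₂ => q₁ + q₂) S M →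
        IsLeftRightScattering H T Δ R H T Δ R S := by
  refine ⟨hR.exists_hasMatrixFunction hV, fun M hM hF => ⟨⟨_, hM.paritySnd_conj⟩, fun S hS => ?_⟩⟩
  exact hR.isLeftRightScattering hV hM hF hS
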